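/- For a commutative ring $R$, a unimodular symmetric form over $R$ is a pair $(M,\varphi)$ of a finitely generated projective $R$-module $M$ and a symmetric bilinear form $\varphi\colon M\times M\to R$ whose adjoint map $M\to M^\vee=\mathrm{Hom}_R(M,R)$ is an isomorphism. Isometry classes of such forms are a commutative semiring $\mathrm{Sym}(R)$ under orthogonal sum and tensor product. The symmetric Grothendieck--Witt ring $\mathrm{GW}^{\mathrm{sym}}(R)$ is its group completion. A form is metabolic if it has a lagrangian, that is, a finitely generated projective submodule $L\subseteq M$ with $\varphi|_{L\times L}=0$ such that the induced map $M/L\to L^\vee$ is an isomorphism. The symmetric Witt ring $\mathrm{W}^{\mathrm{sym}}(R)$ is the quotient of $\mathrm{GW}^{\mathrm{sym}}(R)$ by the ideal generated by the classes of metabolic forms. A ring homomorphism $R\to A$ induces a ring homomorphism $\mathrm{GW}^{\mathrm{sym}}(R)\to\mathrm{GW}^{\mathrm{sym}}(A)$ by extension of scalars. Let $\mathbb{Z}_2$ be the ring of $2$-adic integers. 1. For all $m\ge n\ge 3$ the canonical projections $\mathbb{Z}/2^m\to\mathbb{Z}/2^n$ and $\mathbb{Z}_2\to\mathbb{Z}/2^n$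 induce isomorphisms $$\mathrm{GW}^{\mathrm{sym}}(\mathbb{Z}/2^m)\xrightarrow{\ \cong\ }\mathrm{GW}^{\mathrm{sym}}(\mathbb{Z}/2^n),\qquad \mathrm{GW}^{\mathrm{sym}}(\mathbb{Z}_2)\xrightarrow{\ \cong\ }\mathrm{GW}^{\mathrm{sym}}(\mathbb{Z}/2^n);$$ in particular all these rings are isomorphic to $\mathrm{GW}^{\mathrm{sym}}(\mathbb{Z}/8)$ through the projections. 2. For all $n\ge 3$ there are isomorphisms of abelian groups $$\mathrm{GW}^{\mathrm{sym}}(\mathbb{Z}/2^n)\cong\mathrm{GW}^{\mathrm{sym}}(\mathbb{Z}_2)\cong\mathbb{Z}\oplus\mathbb{Z}/4\oplus\mathbb{Z}/2 .$$ 3. For all $n\ge 3$ the isomorphism $\mathrm{GW}^{\mathrm{sym}}(\mathbb{Z}_2)\cong\mathrm{GW}^{\mathrm{sym}}(\mathbb{Z}/2^n)$ of part 1 descends to a ring isomorphism $\mathrm{W}^{\mathrm{sym}}(\mathbb{Z}_2)\cong\mathrm{W}^{\mathrm{sym}}(\mathbb{Z}/2^n)$, and there are isomorphisms of abelian groups $$\mathrm{W}^{\mathrm{sym}}(\mathbb{Z}/2^n)\cong\mathrm{W}^{\mathrm{sym}}(\mathbb{Z}_2)\cong\mathbb{Z}/8\oplus\mathbb{Z}/2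 .$$ -/

import Mathlib

open scoped TensorProduct

universe u

/-! ### Ring structure on the group completion of a commutative semiring -/

namespace GroupCompletion

open Algebra

variable {S T : Type*} [CommSemiring S] [CommSemiring T]

/-- The canonical map from `S` to its group completion. -/
noncomputable def incl : S →+ GrothendieckAddGroup S := GrothendieckAddGroup.of

theorem hom_ext {G : Type*} [AddCommGroup G] {f g : GrothendieckAddGroup S →+ G}
    (h : ∀ s : S, f (incl s) = g (incl s)) : f = g :=
  GrothendieckAddGroup.lift.symm.injective (AddMonoidHom.ext h)

@[simp]
theorem lift_incl {G : Type*} [AddCommGroup G] (f : S →+ G) (s : S) :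
    GrothendieckAddGroup.lift f (incl s) = f s :=
  DFunLike.congr_fun (GrothendieckAddGroup.lift.symm_apply_apply f) s

/-- The biadditive extension of the multiplication of `S` to its group completion. -/
noncomputable def mulHom :
    GrothendieckAddGroup S →+ GrothendieckAddGroup S →+ GrothendieckAddGroup S :=
  GrothendieckAddGroup.lift
    { toFun := fun s =>
        GrothendieckAddGroup.lift (incl.comp (AddMonoidHom.mulLeft s))
      map_zero' := hom_ext fun t => by simp
      map_add' := fun s s' => hom_ext fun t => by simp [add_mul] }

theorem mulHom_incl (s t : S) :
    mulHom (incl s) (incl t)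
      = incl (s * t) := by
  simp [mulHom]

theorem induction {p : GrothendieckAddGroup S → Prop}
    (of : ∀ s, p (incl s))
    (sub : ∀ x y, p x → p y → p (x - y)) (x : GrothendieckAddGroup S) : p x := by
  induction x using AddLocalization.ind with
  | _ y =>
    obtain ⟨a, b⟩ := y
    have h := sub _ _ (of a) (of b)
    have e : incl a - incl (b : S)
        = AddLocalization.mk a b := by
      rw [incl, GrothendieckAddGroup.of]
      simp only [AddSubmonoid.LocalizationMap.toAddMonoidHom_apply,
        ← AddLocalization.mk_zero_eq_addMonoidOf_mk]
      rw [GrothendieckAddGroup.mk_sub_mk]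
      congr 1
      · simp
      · ext; simp
    rwa [e] at h

/-- The group completion of a commutative semiring is a commutative ring, with
`incl s * incl t = incl (s * t)`; the additive structure is the one of the group completion. -/
noncomputable instance : CommRing (GrothendieckAddGroup S) where
  __ : AddCommGroup (GrothendieckAddGroup S) := inferInstance
  mul x y := mulHom x y
  one := incl 1
  left_distrib x y z := (mulHom x).map_add y z
  right_distrib x y z := by
    change mulHom (x + y) z = mulHom x z + mulHom y z
    simp
  zero_mul x := by
    change mulHom 0 x = 0
    simp
  mul_zero x := (mulHom x).map_zero
  mul_assoc x y z := by
    change mulHom (mulHom x y) z = mulHom x (mulHom y z)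
    induction x using induction with
    | sub x x' hx hx' => simp [hx, hx']
    | of x =>
      induction y using induction with
      | sub y y' hy hy' => simp [hy, hy']
      | of y =>
        induction z using induction with
        | sub z z' hz hz' => simp only [map_sub, hz, hz']
        | of z => simp only [mulHom_incl, mul_assoc]
  one_mul x := by
    change mulHom (incl 1) x = x
    induction x using induction with
    | sub x x' hx hx' => simp only [map_sub, hx, hx']
    | of x => simp only [mulHom_incl, one_mul]
  mul_one x := by
    change mulHom x (incl 1) = x
    induction x using induction with
    | sub x x' hx hx' => simp only [map_sub, AddMonoidHom.sub_apply, hx, hx']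
    | of x => simp only [mulHom_incl, mul_one]
  mul_comm x y := by
    change mulHom x y = mulHom y x
    induction x using induction with
    | sub x x' hx hx' => simp only [map_sub, AddMonoidHom.sub_apply, hx, hx']
    | of x =>
      induction y using induction with
      | sub y y' hy hy' => simp only [map_sub, AddMonoidHom.sub_apply, hy, hy']
      | of y => simp only [mulHom_incl, mul_comm]

theorem incl_mul_incl (s t : S) :
    (incl s * incl t : GrothendieckAddGroup S)
      = incl (s * t) :=
  mulHom_incl s t

/-- Functoriality of the group completion in the semiring. -/
noncomputable def map (f : S →+* T) : GrothendieckAddGroup S →+* GrothendieckAddGroup T where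
  __ := GrothendieckAddGroup.lift (incl.comp (f : S →+ T))
  map_one' := by
    change GrothendieckAddGroup.lift _ (incl 1) = incl 1
    simp
  map_mul' x y := by
    change GrothendieckAddGroup.lift _ (x * y)
      = GrothendieckAddGroup.lift _ x * GrothendieckAddGroup.lift _ y
    induction x using induction with
    | sub x x' hx hx' => simp only [sub_mul, map_sub, hx, hx']
    | of x =>
      induction y using induction with
      | sub y y' hy hy' => simp only [mul_sub, map_sub, hy, hy']
      | of y => simp [incl_mul_incl]

end GroupCompletion

/-! ### Unimodular symmetric forms -/

/-- A finitely generated projective `R`-module with a unimodular symmetric bilinear form: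
the adjoint map `M → M^∨`, `x ↦ φ(x, -)`, is bijective. -/
structure UnimodularForm (R : Type u) [CommRing R] where
  carrier : Type u
  [addCommGroup : AddCommGroup carrier]
  [module : Module R carrier]
  [finite : Module.Finite R carrier]
  [projective : Module.Projective R carrier]
  form : LinearMap.BilinForm R carrier
  symm : ∀ x y, form x y = form y x
  unimodular : Function.Bijective (form : carrier → Module.Dual R carrier)

namespace UnimodularForm

attribute [instance] addCommGroup module finite projective

section Unimodular

variable {R M : Type*} [CommRing R] [AddCommGroup M] [Module R M] (B : LinearMap.BilinForm R M)

theorem exists_coframe [Module.Finite R M] [Module.Projective R M]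
    (hs : ∀ x y, B x y = B y x) (h : Function.Bijective (B : M → Module.Dual R M)) :
    ∃ (n : ℕ) (x y : Fin n → M), ∀ m, ∑ i, B m (x i) • y i = m := by
  obtain ⟨n, f, g, -, -, hfg⟩ := Module.Finite.exists_comp_eq_id_of_projective R M
  choose x hx using fun i : Fin n => h.2 ((LinearMap.proj i).comp g)
  refine ⟨n, x, fun i => f (Pi.single i 1), fun m => ?_⟩
  have h1 : ∀ i, B m (x i) = g m i := fun i => by rw [hs, hx]; rfl
  have h2 : f (g m) = m := DFunLike.congr_fun hfg m
  simp_rw [h1]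
  conv_rhs => rw [← h2, pi_eq_sum_univ' (g m)]
  rw [map_sum]
  refine Finset.sum_congr rfl fun i _ => ?_
  rw [← map_smul]

theorem bijective_of_coframe (hs : ∀ x y, B x y = B y x) {ι : Type*} [Fintype ι] (x y : ι → M)
    (h : ∀ m, ∑ i, B m (x i) • y i = m) : Function.Bijective (B : M → Module.Dual R M) := by
  constructor
  · refine (injective_iff_map_eq_zero B).2 fun m hm => ?_
    rw [← h m, hm]
    simp
  · intro g
    refine ⟨∑ i, g (y i) • x i, LinearMap.ext fun m => ?_⟩
    conv_rhs => rw [← h m]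
    simp [map_sum, hs, mul_comm]

end Unimodular

variable {R : Type u} [CommRing R]

/-- Two forms are isometric if there is a linear isomorphism intertwining them. -/
def Isometric (M N : UnimodularForm R) : Prop :=
  ∃ e : M.carrier ≃ₗ[R] N.carrier, ∀ x y, N.form (e x) (e y) = M.form x y

theorem Isometric.refl (M : UnimodularForm R) : M.Isometric M :=
  ⟨LinearEquiv.refl R _, fun _ _ => rfl⟩

theorem Isometric.symm {M N : UnimodularForm R} : M.Isometric N → N.Isometric M :=
  fun ⟨e, he⟩ => ⟨e.symm, fun x y => by rw [← he]; simp⟩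

theorem Isometric.trans {M N P : UnimodularForm R} :
    M.Isometric N → N.Isometric P → M.Isometric P :=
  fun ⟨e, he⟩ ⟨f, hf⟩ => ⟨e.trans f, fun x y => by simp [hf, he]⟩

instance setoid (R : Type u) [CommRing R] : Setoid (UnimodularForm R) :=
  ⟨Isometric, Isometric.refl, Isometric.symm, Isometric.trans⟩

/-- The form on the zero module. -/
def zero (R : Type u) [CommRing R] : UnimodularForm R where
  carrier := PUnit.{u + 1}
  form := 0
  symm _ _ := rfl
  unimodular := ⟨fun _ _ _ => rfl, fun g => ⟨0, LinearMap.ext fun x => by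
    rw [Subsingleton.elim x 0, map_zero, map_zero]⟩⟩

/-- The form `(x, y) ↦ x * y` on `R`. -/
def one (R : Type u) [CommRing R] : UnimodularForm R where
  carrier := R
  form := LinearMap.mul R R
  symm := mul_comm
  unimodular := bijective_of_coframe (LinearMap.mul R R) mul_comm
    (fun _ : Unit => 1) (fun _ => 1) (by simp)

/-- The orthogonal sum of two bilinear forms. -/
def prodForm {R M N : Type*} [CommRing R] [AddCommGroup M] [Module R M] [AddCommGroup N]
    [Module R N] (B : LinearMap.BilinForm R M) (C : LinearMap.BilinForm R N) :
    LinearMap.BilinForm R (M × N) :=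
  B.compl₁₂ (LinearMap.fst R M N) (LinearMap.fst R M N)
    + C.compl₁₂ (LinearMap.snd R M N) (LinearMap.snd R M N)

@[simp]
theorem prodForm_apply {R M N : Type*} [CommRing R] [AddCommGroup M] [Module R M] [AddCommGroup N]
    [Module R N] (B : LinearMap.BilinForm R M) (C : LinearMap.BilinForm R N) (x y : M × N) :
    prodForm B C x y = B x.1 y.1 + C x.2 y.2 := rfl

/-- Orthogonal sum. -/
def orthSum (M N : UnimodularForm R) : UnimodularForm R where
  carrier := M.carrier × N.carrier
  form := prodForm M.form N.form
  symm x y := by simp [M.symm x.1, N.symm x.2]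
  unimodular := by
    constructor
    · refine (injective_iff_map_eq_zero _).2 fun x hx => ?_
      have h1 : M.form x.1 = 0 := LinearMap.ext fun y => by
        simpa using DFunLike.congr_fun hx (y, 0)
      have h2 : N.form x.2 = 0 := LinearMap.ext fun y => by
        simpa using DFunLike.congr_fun hx (0, y)
      exact Prod.ext ((injective_iff_map_eq_zero M.form).1 M.unimodular.1 _ h1)
        ((injective_iff_map_eq_zero N.form).1 N.unimodular.1 _ h2)
    · intro g
      obtain ⟨x, hx⟩ := M.unimodular.2 (g.comp (LinearMap.inl R _ _))
      obtain ⟨y, hy⟩ := N.unimodular.2 (g.comp (LinearMap.inr R _ _))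
      refine ⟨(x, y), LinearMap.ext fun z => ?_⟩
      simp [hx, hy, ← map_add]

/-- The form `(a ⊗ x, b ⊗ y) ↦ B(a, b) * C(x, y)`, with `B` over an `R`-algebra, is perfect
if `B` and `C` are. -/
theorem tmul_bijective {R A M N : Type*} [CommRing R] [CommRing A] [Algebra R A]
    [AddCommGroup M] [Module R M] [Module A M] [IsScalarTower R A M]
    [AddCommGroup N] [Module R N]
    [Module.Finite A M] [Module.Projective A M] [Module.Finite R N] [Module.Projective R N]
    (B : LinearMap.BilinForm A M) (C : LinearMap.BilinForm R N)
    (hBs : ∀ x y, B x y = B y x) (hCs : ∀ x y, C x y = C y x)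
    (hB : Function.Bijective (B : M → Module.Dual A M))
    (hC : Function.Bijective (C : N → Module.Dual R N)) :
    Function.Bijective
      (LinearMap.BilinForm.tmul B C : M ⊗[R] N → Module.Dual A (M ⊗[R] N)) := by
  obtain ⟨m, x, y, h⟩ := exists_coframe B hBs hB
  obtain ⟨n, x', y', h'⟩ := exists_coframe C hCs hC
  refine bijective_of_coframe _
    (fun a b => (LinearMap.IsSymm.tmul (B₁ := B) (B₂ := C) ⟨hBs⟩ ⟨hCs⟩).eq a b)
    (fun p : Fin m × Fin n => x p.1 ⊗ₜ[R] x' p.2) (fun p => y p.1 ⊗ₜ[R] y' p.2) fun t => ?_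
  induction t with
  | zero => simp
  | add s t hs ht =>
    conv_rhs => rw [← hs, ← ht]
    simp only [map_add, LinearMap.add_apply, add_smul, Finset.sum_add_distrib]
  | tmul a b =>
    conv_rhs => rw [← h a, ← h' b]
    rw [TensorProduct.sum_tmul, Fintype.sum_prod_type]
    refine Finset.sum_congr rfl fun i _ => ?_
    rw [TensorProduct.tmul_sum]
    refine Finset.sum_congr rfl fun j _ => ?_
    rw [LinearMap.BilinForm.tensorDistrib_tmul, TensorProduct.tmul_smul, smul_assoc,
      TensorProduct.smul_tmul']

/-- Tensor product, with the form `(x ⊗ y, x' ⊗ y') ↦ φ(x, x') * ψ(y, y')`. -/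
noncomputable def tensor (M N : UnimodularForm R) : UnimodularForm R where
  carrier := M.carrier ⊗[R] N.carrier
  form := LinearMap.BilinForm.tmul M.form N.form
  symm x y := (LinearMap.IsSymm.tmul (B₁ := M.form) (B₂ := N.form) ⟨M.symm⟩ ⟨N.symm⟩).eq x y
  unimodular := tmul_bijective _ _ M.symm N.symm M.unimodular N.unimodular

/-- Extension of scalars, with the form `(a ⊗ x, b ⊗ y) ↦ a * b * φ(x, y)`. -/
noncomputable def baseChange (A : Type u) [CommRing A] [Algebra R A] (M : UnimodularForm R) :
    UnimodularForm A where
  carrier := A ⊗[R] M.carrier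
  form := LinearMap.BilinForm.baseChange A M.form
  symm x y := (LinearMap.BilinForm.IsSymm.baseChange A (B₂ := M.form) ⟨M.symm⟩).eq x y
  unimodular := tmul_bijective _ _ mul_comm M.symm (one A).unimodular M.unimodular

/-- Bilinear forms on a tensor product which agree on pure tensors are equal. -/
theorem form_ext {R A M N : Type*} [CommRing R] [CommRing A] [Algebra R A]
    [AddCommGroup M] [Module R M] [Module A M] [IsScalarTower R A M]
    [AddCommGroup N] [Module R N] {B C : LinearMap.BilinForm A (M ⊗[R] N)}
    (h : ∀ m n m' n', B (m ⊗ₜ n) (m' ⊗ₜ n') = C (m ⊗ₜ n) (m' ⊗ₜ n')) (x y : M ⊗[R] N) :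
    B x y = C x y := by
  induction x with
  | zero => simp
  | add x x' hx hx' => simp [hx, hx']
  | tmul m n =>
    induction y with
    | zero => simp
    | add y y' hy hy' => simp [hy, hy']
    | tmul m' n' => exact h m n m' n'

section Isometries

open TensorProduct

variable {R A M N P M' N' : Type*} [CommRing R] [CommRing A] [Algebra R A]
  [AddCommGroup M] [Module R M] [AddCommGroup N] [Module R N] [AddCommGroup P] [Module R P]
  [AddCommGroup M'] [Module R M'] [AddCommGroup N'] [Module R N']
  (B : LinearMap.BilinForm R M) (C : LinearMap.BilinForm R N) (D : LinearMap.BilinForm R P)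
  (B' : LinearMap.BilinForm R M') (C' : LinearMap.BilinForm R N')

theorem form_congr (e : M ≃ₗ[R] M') (f : N ≃ₗ[R] N') (he : ∀ x y, B' (e x) (e y) = B x y)
    (hf : ∀ x y, C' (f x) (f y) = C x y) (x y : M ⊗[R] N) :
    LinearMap.BilinForm.tmul B' C' (congr e f x) (congr e f y) = LinearMap.BilinForm.tmul B C x y :=
  form_ext (B := (LinearMap.BilinForm.tmul B' C').compl₁₂ (congr e f).toLinearMap (congr e f).toLinearMap)
    (fun m n m' n' => by simp [he, hf]) x y

theorem form_assoc (x y : (M ⊗[R] N) ⊗[R] P) :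
    LinearMap.BilinForm.tmul B (LinearMap.BilinForm.tmul C D) (TensorProduct.assoc R M N P x)
        (TensorProduct.assoc R M N P y)
      = LinearMap.BilinForm.tmul (LinearMap.BilinForm.tmul B C) D x y := by
  refine form_ext (B := (LinearMap.BilinForm.tmul B (LinearMap.BilinForm.tmul C D)).compl₁₂
    (TensorProduct.assoc R M N P).toLinearMap (TensorProduct.assoc R M N P).toLinearMap)
    (fun s p t q => ?_) x y
  induction s with
  | zero => simp
  | add s s' hs hs' => simp only [add_tmul, map_add, LinearMap.add_apply, hs, hs']
  | tmul m n =>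
    induction t with
    | zero => simp
    | add t t' ht ht' => simp only [add_tmul, map_add, ht, ht']
    | tmul m' n' => simp [mul_assoc]

theorem form_comm (x y : M ⊗[R] N) :
    LinearMap.BilinForm.tmul C B (TensorProduct.comm R M N x) (TensorProduct.comm R M N y)
      = LinearMap.BilinForm.tmul B C x y :=
  form_ext (B := (LinearMap.BilinForm.tmul C B).compl₁₂
    (TensorProduct.comm R M N).toLinearMap (TensorProduct.comm R M N).toLinearMap)
    (fun m n m' n' => by simp [mul_comm]) x y

theorem form_lid (x y : R ⊗[R] M) :
    B (TensorProduct.lid R M x) (TensorProduct.lid R M y)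
      = LinearMap.BilinForm.tmul (LinearMap.mul R R) B x y :=
  form_ext (B := B.compl₁₂
    (TensorProduct.lid R M).toLinearMap (TensorProduct.lid R M).toLinearMap)
    (fun m n m' n' => by simp; ring) x y

theorem form_prodRight (x y : M ⊗[R] (N × P)) :
    prodForm (LinearMap.BilinForm.tmul B C) (LinearMap.BilinForm.tmul B D)
        (prodRight R R M N P x) (prodRight R R M N P y)
      = LinearMap.BilinForm.tmul B (prodForm C D) x y :=
  form_ext (B := (prodForm (LinearMap.BilinForm.tmul B C) (LinearMap.BilinForm.tmul B D)).compl₁₂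
    (prodRight R R M N P).toLinearMap (prodRight R R M N P).toLinearMap)
    (fun m n m' n' => by simp [add_mul]) x y

theorem baseChange_congr (e : M ≃ₗ[R] M') (he : ∀ x y, B' (e x) (e y) = B x y)
    (x y : A ⊗[R] M) :
    LinearMap.BilinForm.baseChange A B' (e.baseChange R A M M' x) (e.baseChange R A M M' y)
      = LinearMap.BilinForm.baseChange A B x y :=
  form_ext (B := (LinearMap.BilinForm.baseChange A B').compl₁₂
    (e.baseChange R A M M').toLinearMap (e.baseChange R A M M').toLinearMap)
    (fun m n m' n' => by simp [he]) x y

theorem baseChange_one (x y : A ⊗[R] R) :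
    LinearMap.mul A A (AlgebraTensorModule.rid R A A x) (AlgebraTensorModule.rid R A A y)
      = LinearMap.BilinForm.baseChange A (LinearMap.mul R R) x y :=
  form_ext (B := (LinearMap.mul A A).compl₁₂
    (AlgebraTensorModule.rid R A A).toLinearMap (AlgebraTensorModule.rid R A A).toLinearMap)
    (fun m n m' n' => by simp [mul_smul, smul_comm n n']) x y

theorem baseChange_prod (x y : A ⊗[R] (M × N)) :
    prodForm (LinearMap.BilinForm.baseChange A B) (LinearMap.BilinForm.baseChange A C)
        (prodRight R A A M N x) (prodRight R A A M N y)
      = LinearMap.BilinForm.baseChange A (prodForm B C) x y :=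
  form_ext (B := (prodForm (LinearMap.BilinForm.baseChange A B) (LinearMap.BilinForm.baseChange A C)).compl₁₂
    (prodRight R A A M N).toLinearMap (prodRight R A A M N).toLinearMap)
    (fun m n m' n' => by simp [add_smul]) x y

theorem baseChange_tmul (x y : A ⊗[R] (M ⊗[R] N)) :
    LinearMap.BilinForm.tmul (LinearMap.BilinForm.baseChange A B) (LinearMap.BilinForm.baseChange A C)
        (AlgebraTensorModule.distribBaseChange R A M N x)
        (AlgebraTensorModule.distribBaseChange R A M N y)
      = LinearMap.BilinForm.baseChange A (LinearMap.BilinForm.tmul B C) x y := by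
  refine form_ext (B := (LinearMap.BilinForm.tmul (LinearMap.BilinForm.baseChange A B)
    (LinearMap.BilinForm.baseChange A C)).compl₁₂
    (AlgebraTensorModule.distribBaseChange R A M N).toLinearMap
    (AlgebraTensorModule.distribBaseChange R A M N).toLinearMap)
    (fun a s b t => ?_) x y
  induction s with
  | zero => simp
  | add s s' hs hs' => simp only [tmul_add, map_add, LinearMap.add_apply, hs, hs']
  | tmul m n =>
    induction t with
    | zero => simp
    | add t t' ht ht' => simp only [tmul_add, map_add, ht, ht']
    | tmul m' n' =>
      simp [mul_smul]
      exact smul_comm _ _ _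

end Isometries

/-- A submodule `L` of `M` is a lagrangian for `B` if it is finitely generated projective, `B`
vanishes on `L × L`, and the induced map `M / L → L^∨` is an isomorphism. -/
def IsLagrangian {R M : Type*} [CommRing R] [AddCommGroup M] [Module R M]
    (B : LinearMap.BilinForm R M) (L : Submodule R M) : Prop :=
  Module.Finite R L ∧ Module.Projective R L ∧
    ∃ h : L ≤ LinearMap.ker (L.subtype.dualMap ∘ₗ B),
      Function.Bijective (L.liftQ (L.subtype.dualMap ∘ₗ B) h)

/-- A form is metabolic if it has a lagrangian. -/
def IsMetabolic (M : UnimodularForm R) : Prop :=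
  ∃ L : Submodule R M.carrier, IsLagrangian M.form L

end UnimodularForm

/-! ### The semiring of isometry classes -/

/-- Isometry classes of finitely generated projective unimodular symmetric `R`-modules. -/
def SymClass (R : Type u) [CommRing R] : Type (u + 1) := Quotient (UnimodularForm.setoid R)

namespace SymClass

open UnimodularForm

variable {R : Type u} [CommRing R]

/-- The isometry class of a form. -/
def mk (M : UnimodularForm R) : SymClass R := Quotient.mk _ M

theorem sound {M N : UnimodularForm R} (h : M.Isometric N) : mk M = mk N := Quotient.sound h

theorem ind {p : SymClass R → Prop} (h : ∀ M, p (mk M)) (x : SymClass R) : p x :=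
  Quotient.inductionOn x h

instance : Zero (SymClass R) := ⟨mk (zero R)⟩

instance : One (SymClass R) := ⟨mk (one R)⟩

/-- Addition of isometry classes is the orthogonal sum. -/
instance : Add (SymClass R) :=
  ⟨Quotient.map₂ orthSum fun _ _ ⟨e, he⟩ _ _ ⟨f, hf⟩ =>
    ⟨e.prodCongr f, fun x y => congrArg₂ (· + ·) (he x.1 y.1) (hf x.2 y.2)⟩⟩

/-- Multiplication of isometry classes is the tensor product. -/
noncomputable instance : Mul (SymClass R) :=
  ⟨Quotient.map₂ tensor fun _ _ ⟨e, he⟩ _ _ ⟨f, hf⟩ =>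
    ⟨TensorProduct.congr e f, form_congr _ _ _ _ e f he hf⟩⟩

theorem isometric_of_subsingleton {M N : UnimodularForm R} [Subsingleton M.carrier]
    [Subsingleton N.carrier] : M.Isometric N :=
  ⟨LinearEquiv.ofSubsingleton _ _, fun x y => by
    rw [Subsingleton.elim x 0, map_zero, map_zero, map_zero]; rfl⟩

instance : Subsingleton (zero R).carrier := inferInstanceAs (Subsingleton PUnit.{u + 1})

theorem add_comm' : ∀ x y : SymClass R, x + y = y + x :=
  ind fun _ => ind fun _ => sound ⟨LinearEquiv.prodComm R _ _, fun _ _ => add_comm _ _⟩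

theorem mul_comm' : ∀ x y : SymClass R, x * y = y * x :=
  ind fun _ => ind fun _ => sound ⟨TensorProduct.comm R _ _, form_comm _ _⟩

theorem zero_add' : ∀ x : SymClass R, 0 + x = x :=
  ind fun M => sound (M := (zero R).orthSum M)
    ⟨LinearEquiv.uniqueProd (R := R) (M := M.carrier) (M₂ := PUnit.{u + 1}),
      fun x y => (zero_add (M.form x.2 y.2)).symm⟩

theorem one_mul' : ∀ x : SymClass R, 1 * x = x :=
  ind fun M => sound (M := (one R).tensor M) ⟨TensorProduct.lid R M.carrier, form_lid M.form⟩

theorem zero_mul' : ∀ x : SymClass R, 0 * x = 0 :=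
  ind fun M => by
    have : Subsingleton ((zero R).tensor M).carrier :=
      inferInstanceAs (Subsingleton (PUnit.{u + 1} ⊗[R] M.carrier))
    exact sound (M := (zero R).tensor M) isometric_of_subsingleton

theorem mul_add' : ∀ x y z : SymClass R, x * (y + z) = x * y + x * z :=
  ind fun _ => ind fun _ => ind fun _ =>
    sound ⟨TensorProduct.prodRight R R _ _ _, form_prodRight _ _ _⟩

/-- Isometry classes form a commutative semiring under orthogonal sum and tensor product. -/
noncomputable instance : CommSemiring (SymClass R) where
  nsmul := nsmulRec
  add_assoc := ind fun _ => ind fun _ => ind fun _ =>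
    sound ⟨LinearEquiv.prodAssoc R _ _ _, fun _ _ => (add_assoc _ _ _).symm⟩
  zero_add := zero_add'
  add_zero x := (add_comm' x 0).trans (zero_add' x)
  add_comm := add_comm'
  mul_assoc := ind fun _ => ind fun _ => ind fun _ =>
    sound ⟨TensorProduct.assoc R _ _ _, form_assoc _ _ _⟩
  mul_comm := mul_comm'
  one_mul := one_mul'
  mul_one x := (mul_comm' x 1).trans (one_mul' x)
  zero_mul := zero_mul'
  mul_zero x := (mul_comm' x 0).trans (zero_mul' x)
  left_distrib := mul_add'
  right_distrib x y z := by
    rw [mul_comm' (x + y) z, mul_comm' x z, mul_comm' y z]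
    exact mul_add' z x y

theorem mk_add_mk (M N : UnimodularForm R) : mk M + mk N = mk (M.orthSum N) := rfl

theorem mk_mul_mk (M N : UnimodularForm R) : mk M * mk N = mk (M.tensor N) := rfl

/-- Extension of scalars of isometry classes along an algebra. -/
noncomputable def mapAlg (R A : Type u) [CommRing R] [CommRing A] [Algebra R A] :
    SymClass R →+* SymClass A where
  toFun := Quotient.map (baseChange A) fun _ _ ⟨e, he⟩ =>
    ⟨e.baseChange R A _ _, baseChange_congr _ _ e he⟩
  map_zero' := by
    have : Subsingleton ((zero R).baseChange A).carrier :=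
      inferInstanceAs (Subsingleton (A ⊗[R] PUnit.{u + 1}))
    exact sound (M := (zero R).baseChange A) isometric_of_subsingleton
  map_one' := sound (M := (one R).baseChange A) (N := one A)
    ⟨TensorProduct.AlgebraTensorModule.rid R A A, baseChange_one (R := R) (A := A)⟩
  map_add' := ind fun _ => ind fun _ =>
    sound ⟨TensorProduct.prodRight R A A _ _, baseChange_prod _ _⟩
  map_mul' := ind fun _ => ind fun _ =>
    sound ⟨TensorProduct.AlgebraTensorModule.distribBaseChange R A _ _, baseChange_tmul _ _⟩

/-- Extension of scalars of isometry classes along a ring homomorphism. -/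
noncomputable def map {R A : Type u} [CommRing R] [CommRing A] (f : R →+* A) :
    SymClass R →+* SymClass A :=
  letI := f.toAlgebra
  mapAlg R A

end SymClass

/-! ### Grothendieck-Witt and Witt rings -/

/-- The symmetric Grothendieck-Witt ring: the group completion of the semiring of isometry
classes. -/
abbrev GWSym (R : Type u) [CommRing R] : Type (u + 1) := Algebra.GrothendieckAddGroup (SymClass R)

namespace GWSym

/-- The class of a form in the Grothendieck-Witt ring. -/
noncomputable def ofForm {R : Type u} [CommRing R] (M : UnimodularForm R) : GWSym R :=
  GroupCompletion.incl (SymClass.mk M)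

/-- The map of Grothendieck-Witt rings induced by extension of scalars. -/
noncomputable def map {R A : Type u} [CommRing R] [CommRing A] (f : R →+* A) :
    GWSym R →+* GWSym A :=
  GroupCompletion.map (SymClass.map f)

/-- The ideal generated by the classes of metabolic forms. -/
noncomputable def metabolicIdeal (R : Type u) [CommRing R] : Ideal (GWSym R) :=
  Ideal.span {x | ∃ M : UnimodularForm R, M.IsMetabolic ∧ x = ofForm M}

end GWSym

/-- The symmetric Witt ring. -/
abbrev WSym (R : Type u) [CommRing R] : Type (u + 1) := GWSym R ⧸ GWSym.metabolicIdeal R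

/-! Each ring `R` in question is local, its elements congruent to 1 modulo 8 are squares of units,
and every unit is congruent to 1, 3, 5 or 7 modulo 8; `HasDyadicSquareClasses` records the last two
facts. For `ℤ_[2]` they come from Hensel's lemma and reduction modulo 8, and they pass to `ℤ/2^n`.
All the rings are then treated at once by computing GW with generators and relations.

Generators: over a local ring a form representing a unit is diagonalizable
(`mk_mem_diagonalClasses`), and every form represents a unit after adding ⟨1⟩. So GW is generated by
⟨1⟩, ⟨3⟩, ⟨5⟩, ⟨7⟩. Explicit isometries give 2⟨5⟩ = 2⟨1⟩, ⟨1⟩ + ⟨3⟩ = ⟨5⟩ + ⟨7⟩ and 4⟨3⟩ = 4⟨1⟩.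
Hence `comparison`, from ℤ ⊕ ℤ/4 ⊕ ℤ/2 to GW, is well defined and surjective.

No further relations: `comparison` commutes with ring homomorphisms and every ring here maps to
`ℤ/8`, so injectivity need only be proved there. Gauss sums ∑ ψ(φ(x, x)) are isometry invariants and
multiplicative in orthogonal sums; taken with values in ℚ and in the field with 17 elements they
detect the three coordinates. As `comparison` is bijective for source and target, all the
projections are isomorphisms.

Witt groups: over a local ring every metabolic form is a sum of planes with Gram matrix (0, 1; 1,
a), and all such planes have the class H = ⟨1⟩ + ⟨-1⟩ in GW. Since ⟨a⟩H = H, the metabolic ideal is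
ℤH. In coordinates H = (2, 1, 1), and the quotient by it is ℤ/8 ⊕ ℤ/2. -/

namespace UnimodularForm

/-! ### Isometries and orthogonal splittings -/

section Splitting

variable {R : Type*} [CommRing R]

/-- A form-preserving surjective linear map out of a nondegenerate form is an isometry. -/
theorem exists_isometry_of_surjective {M N : Type*} [AddCommGroup M] [Module R M]
    [AddCommGroup N] [Module R N] {B : LinearMap.BilinForm R M} {C : LinearMap.BilinForm R N}
    (hB : Function.Injective B) (f : M →ₗ[R] N) (hf : ∀ x y, C (f x) (f y) = B x y)
    (hs : Function.Surjective f) : ∃ e : M ≃ₗ[R] N, ∀ x y, C (e x) (e y) = B x y := by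
  refine ⟨LinearEquiv.ofBijective f ⟨?_, hs⟩, hf⟩
  refine (injective_iff_map_eq_zero f).2 fun x hx => ?_
  refine (injective_iff_map_eq_zero B).1 hB x (LinearMap.ext fun y => ?_)
  rw [← hf, hx, map_zero]
  rfl

variable {P M : Type*} [AddCommGroup P] [Module R P] [AddCommGroup M] [Module R M]
  {B : LinearMap.BilinForm R P} (hB : Function.Bijective (B : P → Module.Dual R P))
  (C : LinearMap.BilinForm R M) (i : P →ₗ[R] M)

/-- The orthogonal projection along a linear map out of a unimodular form. -/
noncomputable def projection : M →ₗ[R] P :=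
  (LinearEquiv.ofBijective B hB).symm.toLinearMap ∘ₗ i.dualMap ∘ₗ C

theorem form_projection (m : M) (p : P) : B (projection hB C i m) p = C m (i p) := by
  have h : B (projection hB C i m) = i.dualMap (C m) :=
    LinearEquiv.apply_symm_apply (LinearEquiv.ofBijective B hB) _
  rw [h]
  rfl

theorem mem_ker_projection {m : M} :
    m ∈ LinearMap.ker (projection hB C i) ↔ ∀ p, C m (i p) = 0 := by
  rw [LinearMap.mem_ker]
  constructor
  · intro h p
    rw [← form_projection hB, h, map_zero]
    rfl
  · intro h
    refine (injective_iff_map_eq_zero B).1 hB.1 _ (LinearMap.ext fun p => ?_)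
    rw [form_projection, h]
    rfl

variable {C i} (hi : ∀ x y, C (i x) (i y) = B x y)
include hi

theorem projection_apply_self (p : P) : projection hB C i (i p) = p := by
  refine hB.1 (LinearMap.ext fun q => ?_)
  rw [form_projection, hi]

theorem sub_mem_ker_projection (m : M) :
    m - i (projection hB C i m) ∈ LinearMap.ker (projection hB C i) := by
  rw [LinearMap.mem_ker, map_sub, projection_apply_self hB hi, sub_self]

/-- This exhibits the orthogonal complement as a direct summand: it is therefore finitely generated
projective, and functionals on it extend to the whole module. -/
theorem exists_retraction_ker_projection :
    ∃ r : M →ₗ[R] LinearMap.ker (projection hB C i),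
      r ∘ₗ (LinearMap.ker (projection hB C i)).subtype = LinearMap.id := by
  refine ⟨(LinearMap.id - i ∘ₗ projection hB C i).codRestrict _ (sub_mem_ker_projection hB hi),
    LinearMap.ext fun x => Subtype.ext ?_⟩
  change (x : M) - i (projection hB C i x) = x
  rw [LinearMap.mem_ker.1 x.2, map_zero, sub_zero]

/-- A vector of the complement orthogonal to the complement is also orthogonal to the image of `i`,
hence to everything. A functional is extended by the retraction, represented by some `m`, and `m` is
replaced by its component in the complement, which pairs the same way there. -/
theorem bijective_restrict_ker_projection (hs : ∀ x y, C x y = C y x)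
    (hC : Function.Bijective (C : M → Module.Dual R M)) :
    Function.Bijective (C.domRestrict₁₂ (LinearMap.ker (projection hB C i))
      (LinearMap.ker (projection hB C i))) := by
  constructor
  · refine (injective_iff_map_eq_zero _).2 fun x hx => Subtype.ext ?_
    refine (injective_iff_map_eq_zero C).1 hC.1 _ (LinearMap.ext fun m => ?_)
    have h1 : C x (m - i (projection hB C i m)) = 0 :=
      DFunLike.congr_fun hx ⟨_, sub_mem_ker_projection hB hi m⟩
    rw [map_sub, (mem_ker_projection hB C i).1 x.2, sub_zero] at h1
    exact h1
  · intro g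
    obtain ⟨r, hr⟩ := exists_retraction_ker_projection hB hi
    obtain ⟨m, hm⟩ := hC.2 (g ∘ₗ r)
    refine ⟨⟨_, sub_mem_ker_projection hB hi m⟩, LinearMap.ext fun x => ?_⟩
    change C (m - i (projection hB C i m)) x = g x
    rw [map_sub, LinearMap.sub_apply, hs (i _), (mem_ker_projection hB C i).1 x.2, sub_zero, hm]
    exact congrArg g (DFunLike.congr_fun hr x)

theorem exists_isometry_prod_ker_projection (hs : ∀ x y, C x y = C y x) :
    ∃ e : (P × LinearMap.ker (projection hB C i)) ≃ₗ[R] M, ∀ x y,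
      C (e x) (e y) = prodForm B (C.domRestrict₁₂ (LinearMap.ker (projection hB C i))
        (LinearMap.ker (projection hB C i))) x y := by
  have hz : ∀ x : LinearMap.ker (projection hB C i), ∀ p, C x (i p) = 0 := fun x =>
    (mem_ker_projection hB C i).1 x.2
  refine ⟨LinearEquiv.ofBijective (i.coprod (Submodule.subtype _)) ⟨?_, fun m => ?_⟩,
    fun x y => ?_⟩
  · refine (injective_iff_map_eq_zero _).2 fun x hx => ?_
    obtain ⟨p, x⟩ := x
    have hx' : i p + (x : M) = 0 := hx
    have hp : p = 0 := by
      rw [← projection_apply_self hB hi p, eq_neg_of_add_eq_zero_left hx', map_neg,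
        LinearMap.mem_ker.1 x.2, neg_zero]
    subst hp
    rw [map_zero, zero_add] at hx'
    exact Prod.ext rfl (Subtype.ext hx')
  · refine ⟨(projection hB C i m, ⟨_, sub_mem_ker_projection hB hi m⟩), ?_⟩
    change i (projection hB C i m) + (m - i (projection hB C i m)) = m
    abel
  · obtain ⟨p, x⟩ := x
    obtain ⟨q, y⟩ := y
    change C (i p + (x : M)) (i q + (y : M)) = B p q + C x y
    have hy := hz y p
    rw [hs] at hy
    simp [hi, hz x q, hy]

end Splitting

variable {R : Type u} [CommRing R]

/-- The orthogonal complement of an isometrically embedded unimodular form. -/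
noncomputable def complement {P : Type*} [AddCommGroup P] [Module R P]
    {B : LinearMap.BilinForm R P} (hB : Function.Bijective (B : P → Module.Dual R P))
    (M : UnimodularForm R) {i : P →ₗ[R] M.carrier} (hi : ∀ x y, M.form (i x) (i y) = B x y) :
    UnimodularForm R where
  carrier := LinearMap.ker (projection hB M.form i)
  finite := by
    obtain ⟨r, hr⟩ := exists_retraction_ker_projection hB hi
    exact Module.Finite.of_surjective r fun x => ⟨x, DFunLike.congr_fun hr x⟩
  projective := by
    obtain ⟨r, hr⟩ := exists_retraction_ker_projection hB hi
    exact Module.Projective.of_split _ r hr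
  form := M.form.domRestrict₁₂ _ _
  symm x y := M.symm _ _
  unimodular := bijective_restrict_ker_projection hB hi M.symm M.unimodular

theorem isometric_orthSum_complement (P M : UnimodularForm R) {i : P.carrier →ₗ[R] M.carrier}
    (hi : ∀ x y, M.form (i x) (i y) = P.form x y) :
    (P.orthSum (M.complement P.unimodular hi)).Isometric M :=
  exists_isometry_prod_ker_projection P.unimodular hi M.symm

/-! ### Forms of rank one and metabolic planes -/

theorem bijective_smul_mul {R : Type*} [CommRing R] {a : R} (ha : IsUnit a) :
    Function.Bijective (a • LinearMap.mul R R : R → Module.Dual R R) :=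
  bijective_of_coframe (a • LinearMap.mul R R) (by simp [mul_comm])
    (fun _ : Unit => (1 : R)) (fun _ => (↑ha.unit⁻¹ : R)) (fun m => by
      simp only [Finset.univ_unique, Finset.sum_const, Finset.card_singleton, one_smul,
        LinearMap.smul_apply, LinearMap.mul_apply', smul_eq_mul, mul_one]
      linear_combination m * ha.mul_val_inv)

/-- The form `(x, y) ↦ a * x * y` on `R`, for a unit `a`. -/
def rankOne (a : R) (ha : IsUnit a) : UnimodularForm R where
  carrier := R
  form := a • LinearMap.mul R R
  symm x y := by simp [mul_comm]
  unimodular := bijective_smul_mul ha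

/-- The bilinear form on `R × R` with Gram matrix `(0, 1; 1, a)`. -/
def planeForm {R : Type*} [CommRing R] (a : R) : LinearMap.BilinForm R (R × R) :=
  LinearMap.mk₂ R (fun x y => x.1 * y.2 + x.2 * y.1 + a * (x.2 * y.2))
    (fun x x' y => by simp; ring) (fun c x y => by simp; ring)
    (fun x y y' => by simp; ring) (fun c x y => by simp; ring)

@[simp]
theorem planeForm_apply {R : Type*} [CommRing R] (a : R) (x y : R × R) :
    planeForm a x y = x.1 * y.2 + x.2 * y.1 + a * (x.2 * y.2) := rfl

theorem bijective_planeForm {R : Type*} [CommRing R] (a : R) :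
    Function.Bijective (planeForm a : R × R → Module.Dual R (R × R)) := by
  constructor
  · refine (injective_iff_map_eq_zero _).2 fun x hx => ?_
    have h1 : x.2 = 0 := by simpa using DFunLike.congr_fun hx ((1, 0) : R × R)
    have h2 : x.1 = 0 := by simpa [h1] using DFunLike.congr_fun hx ((0, 1) : R × R)
    exact Prod.ext h2 h1
  · intro g
    refine ⟨(g (0, 1) - a * g (1, 0), g (1, 0)), LinearMap.ext fun y => ?_⟩
    have h : y = y.1 • ((1, 0) : R × R) + y.2 • ((0, 1) : R × R) := by ext <;> simp
    conv_rhs => rw [h]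
    simp only [map_add, map_smul, smul_eq_mul, planeForm_apply]
    ring

/-- The unimodular form on `R × R` with Gram matrix `(0, 1; 1, a)`. -/
def plane (a : R) : UnimodularForm R where
  carrier := R × R
  form := planeForm a
  symm x y := by simp; ring
  unimodular := bijective_planeForm a

theorem rankOne_isometric {a b s : R} (ha : IsUnit a) (hb : IsUnit b) (hs : IsUnit s)
    (h : b = a * s ^ 2) : (rankOne b hb).Isometric (rankOne a ha) := by
  refine exists_isometry_of_surjective (B := b • LinearMap.mul R R) (C := a • LinearMap.mul R R)
    (bijective_smul_mul hb).1 (LinearMap.mulLeft R s) (fun x y => ?_) fun y => ?_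
  · simp [h]
    ring
  · obtain ⟨t, rfl⟩ := hs
    exact ⟨↑t⁻¹ * y, by simp⟩

theorem rankOne_tensor_isometric {a b : R} (ha : IsUnit a) (hb : IsUnit b) :
    ((rankOne a ha).tensor (rankOne b hb)).Isometric (rankOne (a * b) (ha.mul hb)) :=
  ⟨TensorProduct.lid R R, form_ext
    (C := LinearMap.BilinForm.tmul (a • LinearMap.mul R R) (b • LinearMap.mul R R))
    (B := ((a * b) • LinearMap.mul R R).compl₁₂ (TensorProduct.lid R R).toLinearMap
      (TensorProduct.lid R R).toLinearMap) fun m n m' n' => by simp; ring⟩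

theorem rankOne_baseChange_isometric {A : Type u} [CommRing A] [Algebra R A] {a : R}
    (ha : IsUnit a) (hb : IsUnit (algebraMap R A a)) :
    ((rankOne a ha).baseChange A).Isometric (rankOne (algebraMap R A a) hb) :=
  ⟨TensorProduct.AlgebraTensorModule.rid R A A, form_ext
    (C := LinearMap.BilinForm.baseChange A (a • LinearMap.mul R R))
    (B := (algebraMap R A a • LinearMap.mul A A).compl₁₂
      (TensorProduct.AlgebraTensorModule.rid R A A).toLinearMap
      (TensorProduct.AlgebraTensorModule.rid R A A).toLinearMap)
    fun m n m' n' => by simp [Algebra.smul_def]; ring⟩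

/-- A vector of unit norm splits off. -/
theorem exists_rankOne_orthSum (M : UnimodularForm R) (v : M.carrier)
    (hv : IsUnit (M.form v v)) :
    ∃ N : UnimodularForm R, ((rankOne _ hv).orthSum N).Isometric M ∧
      ∃ j : N.carrier →ₗ[R] M.carrier, (∀ x y, M.form (j x) (j y) = N.form x y) ∧
        ∀ x, M.form x v = 0 ↔ ∃ y, j y = x := by
  have hi : ∀ x y, M.form (LinearMap.toSpanSingleton R _ v x) (LinearMap.toSpanSingleton R _ v y)
      = (M.form v v • LinearMap.mul R R) x y := fun x y => by simp; ring
  refine ⟨complement (bijective_smul_mul hv) M hi, isometric_orthSum_complement (rankOne _ hv) M hi,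
    Submodule.subtype _, fun _ _ => rfl, fun x => ⟨fun h => ⟨⟨x, ?_⟩, rfl⟩, ?_⟩⟩
  · rw [mem_ker_projection]
    intro p
    simp [h]
  · rintro ⟨y, rfl⟩
    have h := (mem_ker_projection _ _ _).1 y.2 (1 : R)
    rw [LinearMap.toSpanSingleton_apply, one_smul] at h
    exact h

end UnimodularForm

/-! ### Diagonalization over local rings. -/

namespace UnimodularForm

variable {R : Type u} [CommRing R]

instance free_carrier [IsLocalRing R] (M : UnimodularForm R) : Module.Free R M.carrier :=
  Module.free_of_flat_of_isLocalRing

theorem Isometric.finrank_eq {M N : UnimodularForm R} (h : M.Isometric N) :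
    Module.finrank R M.carrier = Module.finrank R N.carrier :=
  h.choose.finrank_eq

theorem finrank_orthSum [IsLocalRing R] (M N : UnimodularForm R) :
    Module.finrank R (M.orthSum N).carrier
      = Module.finrank R M.carrier + Module.finrank R N.carrier :=
  Module.finrank_prod (R := R) (M := M.carrier) (M' := N.carrier)

theorem finrank_rankOne [IsLocalRing R] {a : R} (ha : IsUnit a) :
    Module.finrank R (rankOne a ha).carrier = 1 :=
  Module.finrank_self R

theorem finrank_plane [IsLocalRing R] (a : R) : Module.finrank R (plane a).carrier = 2 := by
  change Module.finrank R (R × R) = 2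
  rw [Module.finrank_prod, Module.finrank_self]

theorem subsingleton_of_finrank_eq_zero [IsLocalRing R] {M : UnimodularForm R}
    (h : Module.finrank R M.carrier = 0) : Subsingleton M.carrier := by
  have : IsEmpty (Fin (Module.finrank R M.carrier)) := by rw [h]; infer_instance
  exact (Module.finBasis R M.carrier).repr.toEquiv.subsingleton

theorem isUnit_add_of_not_isUnit [IsLocalRing R] {u x : R} (hu : IsUnit u) (hx : ¬ IsUnit x) :
    IsUnit (u + x) := by
  by_contra h
  have h1 : -x ∈ nonunits R := by simpa [mem_nonunits_iff] using hx
  exact IsLocalRing.nonunits_add (a := u + x) (b := -x) h h1 (by simpa using hu)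

/-- The sums of isometry classes of forms of rank one. -/
noncomputable def diagonalClasses (R : Type u) [CommRing R] : AddSubmonoid (SymClass R) :=
  AddSubmonoid.closure {c | ∃ (a : R) (ha : IsUnit a), c = SymClass.mk (rankOne a ha)}

theorem rankOne_mem_diagonalClasses {a : R} (ha : IsUnit a) :
    SymClass.mk (rankOne a ha) ∈ diagonalClasses R :=
  AddSubmonoid.subset_closure ⟨a, ha, rfl⟩

/-- Over a local ring, a unimodular form which represents a unit has an orthogonal basis. -/
theorem mk_mem_diagonalClasses [IsLocalRing R] (n : ℕ) :
    ∀ (M : UnimodularForm R), Module.finrank R M.carrier = n → ∀ v, IsUnit (M.form v v) →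
      SymClass.mk M ∈ diagonalClasses R := by
  induction n with
  | zero =>
    intro M hM v hv
    have := subsingleton_of_finrank_eq_zero hM
    rw [Subsingleton.elim v 0, map_zero] at hv
    exact absurd hv not_isUnit_zero
  | succ n ih =>
    intro M hM v hv
    have step : ∀ v' (hv' : IsUnit (M.form v' v')),
        (∃ x, M.form x v' = 0 ∧ IsUnit (M.form x x)) → SymClass.mk M ∈ diagonalClasses R := by
      rintro v' hv' ⟨x, hx, hxu⟩
      obtain ⟨N, hN, j, hj, hj'⟩ := exists_rankOne_orthSum M v' hv'
      obtain ⟨y, rfl⟩ := (hj' x).1 hx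
      rw [hj] at hxu
      have h1 : Module.finrank R N.carrier = n := by
        have := hN.finrank_eq
        rw [finrank_orthSum, finrank_rankOne, hM] at this
        omega
      rw [← SymClass.sound hN, ← SymClass.mk_add_mk]
      exact add_mem (rankOne_mem_diagonalClasses hv') (ih N h1 y hxu)
    -- If the complement of `v` represents a unit, induction applies to it. Otherwise all norms
    -- there are nonunits and `v` itself has to be changed.
    by_cases h : ∃ x, M.form x v = 0 ∧ IsUnit (M.form x x)
    · exact step v hv h
    have h : ∀ x, M.form x v = 0 → ¬ IsUnit (M.form x x) := fun x hx hu => h ⟨x, hx, hu⟩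
    obtain ⟨N, hN, j, hj, hj'⟩ := exists_rankOne_orthSum M v hv
    rcases subsingleton_or_nontrivial N.carrier with hs | hs
    · rw [← SymClass.sound hN, ← SymClass.mk_add_mk]
      have h0 : SymClass.mk N = 0 :=
        SymClass.sound (N := zero R) SymClass.isometric_of_subsingleton
      rw [h0, add_zero]
      exact rankOne_mem_diagonalClasses hv
    · have hr : 0 < Module.finrank R N.carrier := Nat.pos_of_ne_zero fun h0 =>
        not_subsingleton _ (subsingleton_of_finrank_eq_zero h0)
      obtain ⟨x, y, hxy⟩ : ∃ x y : N.carrier, N.form x y = 1 := by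
        let b := Module.finBasis R N.carrier
        obtain ⟨x, hx⟩ := N.unimodular.2 (b.coord ⟨0, hr⟩)
        exact ⟨x, b ⟨0, hr⟩, by rw [hx]; simp⟩
      have hxv : M.form (j x) v = 0 := (hj' _).2 ⟨x, rfl⟩
      have hyv : M.form (j y) v = 0 := (hj' _).2 ⟨y, rfl⟩
      have hvx : M.form v (j x) = 0 := by rw [M.symm, hxv]
      have hvy : M.form v (j y) = 0 := by rw [M.symm, hyv]
      have hyx : M.form (j y) (j x) = 1 := by rw [hj, N.symm, hxy]
      have hxy' : M.form (j x) (j y) = 1 := by rw [hj, hxy]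
      obtain ⟨u, hu⟩ := hv
      -- With `u` the norm of `v`, the new vector has norm `u` plus a nonunit. The second vector
      -- pairs with it to 1 - 1 = 0, since `x` and `y` pair to 1, and its norm is `u⁻¹` plus a
      -- nonunit. Both norms are units because the ring is local.
      refine step (v + j x) ?_ ⟨j y - (↑u⁻¹ : R) • v, ?_, ?_⟩
      · simp only [map_add, LinearMap.add_apply, hvx, hxv, add_zero, zero_add, ← hu]
        exact isUnit_add_of_not_isUnit u.isUnit (h _ hxv)
      · simp only [map_add, map_sub, LinearMap.sub_apply, map_smul, LinearMap.smul_apply, hvx,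
          hyv, hyx, ← hu, smul_eq_mul]
        simp
      · simp only [map_sub, LinearMap.sub_apply, map_smul, LinearMap.smul_apply, hvy,
          hyv, ← hu, smul_eq_mul]
        have := isUnit_add_of_not_isUnit (u⁻¹).isUnit (h _ hyv)
        convert this using 1
        simp
        ring

/-- The added summand supplies the unit norm. In the group completion this makes every class a
difference of diagonal ones. -/
theorem mk_add_one_mem_diagonalClasses [IsLocalRing R] (c : SymClass R) :
    c + SymClass.mk (rankOne 1 isUnit_one) ∈ diagonalClasses R := by
  induction c using SymClass.ind with
  | h M =>
    rw [SymClass.mk_add_mk]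
    refine mk_mem_diagonalClasses _ _ rfl ((0, (1 : R)) : M.carrier × R) ?_
    change IsUnit (M.form 0 0 + ((1 : R) • LinearMap.mul R R) 1 1)
    simp

/-! ### Relations between diagonal forms -/

/-- In ⟨a⟩ ⊕ ⟨b⟩ the vectors (1, 2) and (-2b, a) are orthogonal, of norms a + 4b and ab(a + 4b), and
their determinant is the unit a + 4b. -/
theorem rankOne_orthSum_isometric {a b : R} (ha : IsUnit a) (hb : IsUnit b)
    (hc : IsUnit (a + 4 * b)) :
    ((rankOne (a + 4 * b) hc).orthSum
      (rankOne (a * b * (a + 4 * b)) ((ha.mul hb).mul hc))).Isometric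
      ((rankOne a ha).orthSum (rankOne b hb)) := by
  refine exists_isometry_of_surjective
    (B := prodForm ((a + 4 * b) • LinearMap.mul R R)
      ((a * b * (a + 4 * b)) • LinearMap.mul R R))
    (C := prodForm (a • LinearMap.mul R R) (b • LinearMap.mul R R))
    ((rankOne (a + 4 * b) hc).orthSum
      (rankOne (a * b * (a + 4 * b)) ((ha.mul hb).mul hc))).unimodular.1
    { toFun := fun x => (x.1 - 2 * b * x.2, 2 * x.1 + a * x.2)
      map_add' := fun x y => by ext <;> simp <;> ring
      map_smul' := fun x y => by ext <;> simp <;> ring } (fun x y => ?_) fun y => ?_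
  · simp
    ring
  · obtain ⟨r, hr⟩ := hc.exists_right_inv
    refine ⟨(r * (a * y.1 + 2 * b * y.2), r * (y.2 - 2 * y.1)), Prod.ext ?_ ?_⟩
    · change r * (a * y.1 + 2 * b * y.2) - 2 * b * (r * (y.2 - 2 * y.1)) = y.1
      linear_combination y.1 * hr
    · change 2 * (r * (a * y.1 + 2 * b * y.2)) + a * (r * (y.2 - 2 * y.1)) = y.2
      linear_combination y.2 * hr

/-- The quaternion `1 + i + j` of norm three is a similitude of the sum of four squares. -/
theorem rankOne_four_isometric {a b : R} (ha : IsUnit a) (hb : IsUnit b) (h3 : IsUnit (3 : R))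
    (hab : b = 3 * a) :
    ((rankOne b hb).orthSum ((rankOne b hb).orthSum
      ((rankOne b hb).orthSum (rankOne b hb)))).Isometric
    ((rankOne a ha).orthSum ((rankOne a ha).orthSum
      ((rankOne a ha).orthSum (rankOne a ha)))) := by
  refine exists_isometry_of_surjective
    (B := prodForm (b • LinearMap.mul R R) (prodForm (b • LinearMap.mul R R)
      (prodForm (b • LinearMap.mul R R) (b • LinearMap.mul R R))))
    (C := prodForm (a • LinearMap.mul R R) (prodForm (a • LinearMap.mul R R)
      (prodForm (a • LinearMap.mul R R) (a • LinearMap.mul R R))))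
    ((rankOne b hb).orthSum ((rankOne b hb).orthSum
      ((rankOne b hb).orthSum (rankOne b hb)))).unimodular.1
    { toFun := fun x => (x.1 - x.2.1 - x.2.2.1, x.1 + x.2.1 + x.2.2.2,
        x.1 + x.2.2.1 - x.2.2.2, x.2.2.1 + x.2.2.2 - x.2.1)
      map_add' := fun x y => by ext <;> simp <;> ring
      map_smul' := fun x y => by ext <;> simp <;> ring } (fun x y => ?_) fun y => ?_
  · simp [hab]
    ring
  · obtain ⟨r, hr⟩ := h3.exists_right_inv
    -- The matrix of a similitude of norm 3 is inverted by its transpose divided by 3.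
    refine ⟨(r * (y.1 + y.2.1 + y.2.2.1), r * (y.2.1 - y.1 - y.2.2.2),
      r * (y.2.2.1 + y.2.2.2 - y.1), r * (y.2.1 - y.2.2.1 + y.2.2.2)),
      Prod.ext ?_ (Prod.ext ?_ (Prod.ext ?_ ?_))⟩
    · dsimp
      linear_combination y.1 * hr
    · dsimp
      linear_combination y.2.1 * hr
    · dsimp
      linear_combination y.2.2.1 * hr
    · dsimp
      linear_combination y.2.2.2 * hr

/-- The vectors (0, 1) and (a, -1) form an orthogonal basis of the plane, with norms `a` and `-a`.
-/
theorem plane_isometric {a : R} (ha : IsUnit a) :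
    ((rankOne a ha).orthSum (rankOne (-a) ha.neg)).Isometric (plane a) := by
  refine exists_isometry_of_surjective
    (B := prodForm (a • LinearMap.mul R R) ((-a) • LinearMap.mul R R)) (C := planeForm a)
    ((rankOne a ha).orthSum (rankOne (-a) ha.neg)).unimodular.1
    { toFun := fun x => (a * x.2, x.1 - x.2)
      map_add' := fun x y => by ext <;> simp <;> ring
      map_smul' := fun x y => by ext <;> simp <;> ring } (fun x y => ?_) fun y => ?_
  · simp
    ring
  · obtain ⟨r, hr⟩ := ha.exists_right_inv
    refine ⟨(y.2 + r * y.1, r * y.1), Prod.ext ?_ ?_⟩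
    · dsimp
      linear_combination y.1 * hr
    · dsimp
      ring

/-- With basis e, f of the plane and generator w of ⟨u⟩, replace f by f + w, which raises its norm
by u, and w by w - ue, which restores orthogonality. After cancelling ⟨u⟩ in GW, the class of the
plane is unchanged when a unit is added to its parameter. -/
theorem plane_orthSum_isometric {u : R} (a : R) (hu : IsUnit u) :
    ((plane (a + u)).orthSum (rankOne u hu)).Isometric ((plane a).orthSum (rankOne u hu)) := by
  refine exists_isometry_of_surjective
    (B := prodForm (planeForm (a + u)) (u • LinearMap.mul R R))
    (C := prodForm (planeForm a) (u • LinearMap.mul R R))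
    ((plane (a + u)).orthSum (rankOne u hu)).unimodular.1
    { toFun := fun x => ((x.1.1 - u * x.2, x.1.2), x.1.2 + x.2)
      map_add' := fun x y => by ext <;> simp <;> ring
      map_smul' := fun x y => by ext <;> simp <;> ring } (fun x y => ?_) fun y => ?_
  · simp
    ring
  · refine ⟨((y.1.1 + u * (y.2 - y.1.2), y.1.2), y.2 - y.1.2), Prod.ext (Prod.ext ?_ rfl) ?_⟩
    · dsimp
      ring
    · dsimp
      ring

end UnimodularForm

/-! ### Metabolic forms over local rings -/

namespace UnimodularForm

section Lagrangian

variable {R M : Type*} [CommRing R] [AddCommGroup M] [Module R M] {B : LinearMap.BilinForm R M}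
  {L : Submodule R M}

theorem isLagrangian_iff : IsLagrangian B L ↔ Module.Finite R L ∧ Module.Projective R L ∧
    (∀ x ∈ L, ∀ y ∈ L, B x y = 0) ∧ (∀ m, (∀ x ∈ L, B m x = 0) → m ∈ L) ∧
      ∀ g : Module.Dual R L, ∃ m, ∀ x : L, B m x = g x := by
  refine and_congr_right fun _ => and_congr_right fun _ => ⟨?_, ?_⟩
  · rintro ⟨h, hi, hs⟩
    refine ⟨fun x hx y hy => DFunLike.congr_fun (LinearMap.mem_ker.1 (h hx)) ⟨y, hy⟩,
      fun m hm => ?_, fun g => ?_⟩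
    · rw [← Submodule.Quotient.mk_eq_zero]
      refine (injective_iff_map_eq_zero _).1 hi _ ?_
      rw [Submodule.liftQ_apply]
      exact LinearMap.ext fun x => hm x x.2
    · obtain ⟨m, hm⟩ := hs g
      obtain ⟨m, rfl⟩ := Submodule.mkQ_surjective L m
      rw [Submodule.mkQ_apply, Submodule.liftQ_apply] at hm
      exact ⟨m, DFunLike.congr_fun hm⟩
  · rintro ⟨h, hi, hs⟩
    refine ⟨fun x hx => LinearMap.mem_ker.2 (LinearMap.ext fun y => h x hx y y.2), ?_, fun g => ?_⟩
    · refine (injective_iff_map_eq_zero _).2 fun m hm => ?_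
      obtain ⟨m, rfl⟩ := Submodule.mkQ_surjective L m
      rw [Submodule.mkQ_apply, Submodule.liftQ_apply] at hm
      exact (Submodule.Quotient.mk_eq_zero L).2
        (hi m fun x hx => DFunLike.congr_fun hm (⟨x, hx⟩ : L))
    · obtain ⟨m, hm⟩ := hs g
      exact ⟨L.mkQ m, LinearMap.ext hm⟩

/-- A lagrangian restricts to the complement of a hyperbolic pair whose first vector lies in
it. -/
theorem IsLagrangian.comap_subtype (hB : ∀ x y, B x y = B y x) (hL : IsLagrangian B L) {l m : M}
    (hl : l ∈ L) (hml : B m l = 1) {K : Submodule R M}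
    (hK : ∀ x, x ∈ K ↔ B x l = 0 ∧ B x m = 0) :
    IsLagrangian (B.domRestrict₁₂ K K) (L.comap K.subtype) := by
  obtain ⟨hfin, hproj, h0, hi, hs⟩ := isLagrangian_iff.1 hL
  have hmem : ∀ x : L, (x : M) - B m x • l ∈ K := fun x => by
    rw [hK]
    simp [h0 x x.2 l hl, h0 l hl l hl, hB l m, hml, hB x m]
  -- Subtracting the multiple of `l` that kills the pairing with `m` projects `L` onto `L ∩ K`;
  -- pairing with `l` already vanishes on `L`. This retraction gives projectivity and lets
  -- functionals on `L ∩ K` extend to `L`.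
  let ρ : L →ₗ[R] L.comap K.subtype :=
    ((L.subtype - ((B m).comp L.subtype).smulRight l).codRestrict K hmem).codRestrict _
      fun x => L.sub_mem x.2 (L.smul_mem _ hl)
  have hρ : ∀ x, ((ρ x : K) : M) = x - B m x • l := fun x => rfl
  let ι : L.comap K.subtype →ₗ[R] L :=
    (K.subtype.comp (Submodule.subtype _)).codRestrict L fun x => x.2
  have hρι : ρ ∘ₗ ι = LinearMap.id := LinearMap.ext fun x => by
    refine Subtype.ext (Subtype.ext ?_)
    have h1 : B m (ι x) = 0 := by
      rw [hB]
      exact ((hK _).1 x.1.2).2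
    rw [LinearMap.comp_apply, hρ, h1, zero_smul, sub_zero]
    rfl
  refine isLagrangian_iff.2 ⟨Module.Finite.of_surjective ρ fun x => ⟨ι x, DFunLike.congr_fun hρι x⟩,
    Module.Projective.of_split ι ρ hρι, fun x hx y hy => h0 x hx y hy, fun y hy => ?_, fun g => ?_⟩
  · refine hi y fun x hx => ?_
    have h1 : B y ((ρ ⟨x, hx⟩ : K) : M) = 0 := hy (ρ ⟨x, hx⟩) (ρ ⟨x, hx⟩).2
    rw [hρ, map_sub, map_smul, ((hK y).1 y.2).1, smul_zero, sub_zero] at h1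
    exact h1
  · obtain ⟨m', hm'⟩ := hs (g ∘ₗ ρ)
    have hm'l : B m' l = 0 := by
      have h1 : ρ ⟨l, hl⟩ = 0 := Subtype.ext (Subtype.ext (by rw [hρ, hml]; simp))
      have h2 := hm' ⟨l, hl⟩
      rwa [LinearMap.comp_apply, h1, map_zero] at h2
    have hy : m' - B m' m • l ∈ K := by
      rw [hK]
      simp [hm'l, h0 l hl l hl, hB l m, hml]
    refine ⟨⟨_, hy⟩, fun x => ?_⟩
    have h1 := hm' (ι x)
    rw [LinearMap.comp_apply, show ρ (ι x) = x from DFunLike.congr_fun hρι x] at h1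
    rw [← h1]
    change B (m' - B m' m • l) (ι x) = B m' (ι x)
    simp [h0 l hl _ (ι x).2]

end Lagrangian

variable {R : Type u} [CommRing R]

/-- A nonzero metabolic form over a local ring splits off a metabolic plane. -/
theorem IsMetabolic.exists_plane_orthSum [IsLocalRing R] {M : UnimodularForm R}
    (hM : M.IsMetabolic) (h : Nontrivial M.carrier) :
    ∃ (a : R) (N : UnimodularForm R), N.IsMetabolic ∧ ((plane a).orthSum N).Isometric M := by
  obtain ⟨L, hL⟩ := hM
  obtain ⟨hfin, hproj, h0, hi, hs⟩ := isLagrangian_iff.1 hL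
  have hfree : Module.Free R L := Module.free_of_flat_of_isLocalRing
  -- A zero lagrangian would equal its own orthogonal complement, which is then all of `M`.
  have hr : 0 < Module.finrank R L := Nat.pos_of_ne_zero fun hr => by
    have : IsEmpty (Fin (Module.finrank R L)) := by rw [hr]; infer_instance
    have hsub : Subsingleton L := (Module.finBasis R L).repr.toEquiv.subsingleton
    obtain ⟨m, hm⟩ := exists_ne (0 : M.carrier)
    have hmL : m ∈ L := hi m fun x hx => by
      have : (⟨x, hx⟩ : L) = 0 := Subsingleton.elim _ _
      rw [show x = 0 from congrArg Subtype.val this, map_zero]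
    exact hm (congrArg Subtype.val (Subsingleton.elim (⟨m, hmL⟩ : L) 0))
  let b := Module.finBasis R L
  -- Lifting a coordinate functional of `L` yields a partner for the corresponding basis vector;
  -- together they span the plane with parameter `M.form m m`.
  obtain ⟨m, hm⟩ := hs (b.coord ⟨0, hr⟩)
  obtain ⟨l, hl⟩ : ∃ l, l = b ⟨0, hr⟩ := ⟨_, rfl⟩
  have hml : M.form m l = 1 := by rw [hm, hl]; simp
  have hll : M.form l l = 0 := h0 l l.2 l l.2
  have hform : ∀ x y, M.form (((LinearMap.toSpanSingleton R _ (l : M.carrier)).coprod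
      (LinearMap.toSpanSingleton R _ m)) x) (((LinearMap.toSpanSingleton R _
        (l : M.carrier)).coprod (LinearMap.toSpanSingleton R _ m)) y)
      = planeForm (M.form m m) x y := fun x y => by
    simp [hll, hml, M.symm l m]
    ring
  refine ⟨_, complement (bijective_planeForm (M.form m m)) M hform,
    ⟨_, hL.comap_subtype M.symm l.2 hml fun x => ?_⟩,
    isometric_orthSum_complement (plane (M.form m m)) M hform⟩
  rw [mem_ker_projection]
  constructor
  · intro h
    have h1 := h (1, 0)
    have h2 := h (0, 1)
    simp only [LinearMap.coprod_apply, LinearMap.toSpanSingleton_apply, one_smul, zero_smul,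
      add_zero, zero_add] at h1 h2
    exact ⟨h1, h2⟩
  · rintro ⟨h1, h2⟩ p
    simp [h1, h2]

end UnimodularForm

/-! ### The hyperbolic class and the metabolic ideal. -/

namespace GWSym

open UnimodularForm

variable {R : Type u} [CommRing R]

theorem ofForm_eq {M N : UnimodularForm R} (h : M.Isometric N) : ofForm M = ofForm N :=
  congrArg GroupCompletion.incl (SymClass.sound h)

theorem ofForm_orthSum (M N : UnimodularForm R) :
    ofForm (M.orthSum N) = ofForm M + ofForm N :=
  map_add GroupCompletion.incl (SymClass.mk M) (SymClass.mk N)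

theorem ofForm_mul_ofForm (M N : UnimodularForm R) :
    ofForm M * ofForm N = ofForm (M.tensor N) :=
  GroupCompletion.incl_mul_incl (SymClass.mk M) (SymClass.mk N)

theorem map_ofForm_rankOne {A : Type u} [CommRing A] (f : R →+* A) {a : R} (ha : IsUnit a) :
    map f (ofForm (rankOne a ha)) = ofForm (rankOne (f a) (ha.map f)) := by
  let _ := f.toAlgebra
  refine (GroupCompletion.lift_incl _ _).trans ?_
  exact ofForm_eq (rankOne_baseChange_isometric ha (ha.map (algebraMap R A)))

/-- The class of the form `⟨1⟩ ⊕ ⟨-1⟩`. -/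
noncomputable def hyperbolic (R : Type u) [CommRing R] : GWSym R :=
  ofForm (rankOne 1 isUnit_one) + ofForm (rankOne (-1) isUnit_one.neg)

theorem ofForm_plane_add {u : R} (a : R) (hu : IsUnit u) :
    ofForm (plane (a + u)) = ofForm (plane a) := by
  have h := ofForm_eq (plane_orthSum_isometric a hu)
  rw [ofForm_orthSum, ofForm_orthSum] at h
  exact add_right_cancel h

theorem hyperbolic_eq_plane : hyperbolic R = ofForm (plane (1 : R)) := by
  rw [hyperbolic, ← ofForm_orthSum]
  exact ofForm_eq (plane_isometric isUnit_one)

/-- In a local ring `a` or `1 - a` is a unit, so one addition of a unit links the parameter `a` to 0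
or to 1, and 0 is linked to 1. -/
theorem ofForm_plane [IsLocalRing R] (a : R) : ofForm (plane a) = hyperbolic R := by
  have h0 : ofForm (plane (0 : R)) = hyperbolic R := by
    rw [hyperbolic_eq_plane, ← ofForm_plane_add 0 isUnit_one, zero_add]
  rcases IsLocalRing.isUnit_or_isUnit_one_sub_self a with ha | ha
  · rw [← h0, ← ofForm_plane_add 0 ha, zero_add]
  · rw [hyperbolic_eq_plane, ← ofForm_plane_add a ha]
    congr 2
    ring

theorem ofForm_rankOne_add_neg [IsLocalRing R] {a : R} (ha : IsUnit a) :
    ofForm (rankOne a ha) + ofForm (rankOne (-a) ha.neg) = hyperbolic R := by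
  rw [← ofForm_orthSum, ofForm_eq (plane_isometric ha), ofForm_plane]

theorem isMetabolic_plane_zero : (plane (0 : R)).IsMetabolic := by
  let L : Submodule R (R × R) := LinearMap.range (LinearMap.inl R R R)
  let e : R ≃ₗ[R] L := LinearEquiv.ofInjective _ LinearMap.inl_injective
  refine ⟨L, isLagrangian_iff (B := planeForm (0 : R)).2 ⟨Module.Finite.equiv e,
    Module.Projective.of_equiv e, ?_, fun m hm => ?_, fun g => ?_⟩⟩
  · rintro _ ⟨x, rfl⟩ _ ⟨y, rfl⟩
    simp
  · have h := hm (1, 0) ⟨1, rfl⟩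
    have h2 : m.2 = 0 := by simpa using h
    exact ⟨m.1, Prod.ext rfl h2.symm⟩
  · refine ⟨(0, g (e 1)), fun x => ?_⟩
    obtain ⟨x, rfl⟩ := e.surjective x
    have h1 : e x = x • e 1 := by rw [← map_smul, smul_eq_mul, mul_one]
    have h2 : ((e x : L) : R × R) = (x, 0) := rfl
    rw [h2, h1, map_smul]
    simp [mul_comm]

/-- Over a local ring, the class of a metabolic form is a multiple of the hyperbolic class. -/
theorem exists_ofForm_eq_natCast_mul_hyperbolic [IsLocalRing R] (n : ℕ) :
    ∀ M : UnimodularForm R, Module.finrank R M.carrier ≤ n → M.IsMetabolic →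
      ∃ k : ℕ, ofForm M = k * hyperbolic R := by
  induction n with
  | zero =>
    intro M hM _
    have := subsingleton_of_finrank_eq_zero (Nat.le_zero.1 hM)
    refine ⟨0, ?_⟩
    rw [Nat.cast_zero, zero_mul, ofForm_eq (N := zero R) SymClass.isometric_of_subsingleton]
    exact map_zero GroupCompletion.incl
  | succ n ih =>
    intro M hM hmet
    rcases subsingleton_or_nontrivial M.carrier with h | h
    · refine ⟨0, ?_⟩
      rw [Nat.cast_zero, zero_mul, ofForm_eq (N := zero R) SymClass.isometric_of_subsingleton]
      exact map_zero GroupCompletion.incl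
    · obtain ⟨a, N, hN, e⟩ := hmet.exists_plane_orthSum h
      have hr := e.finrank_eq
      rw [finrank_orthSum, finrank_plane] at hr
      obtain ⟨k, hk⟩ := ih N (by omega) hN
      refine ⟨1 + k, ?_⟩
      rw [Nat.cast_add, Nat.cast_one, add_mul, one_mul]
      rw [← ofForm_eq e, ofForm_orthSum, ofForm_plane, hk]

/-- Over a local ring, the metabolic classes generate the ideal of the hyperbolic class. -/
theorem metabolicIdeal_eq_span [IsLocalRing R] :
    metabolicIdeal R = Ideal.span {hyperbolic R} := by
  refine le_antisymm (Ideal.span_le.2 ?_) (Ideal.span_le.2 ?_)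
  · rintro _ ⟨M, hM, rfl⟩
    obtain ⟨k, hk⟩ := exists_ofForm_eq_natCast_mul_hyperbolic _ M le_rfl hM
    rw [hk]
    exact Ideal.mul_mem_left _ _ (Ideal.subset_span rfl)
  · rintro _ rfl
    exact Ideal.subset_span ⟨plane 0, isMetabolic_plane_zero, (ofForm_plane 0).symm⟩

theorem map_hyperbolic {A : Type u} [CommRing A] (f : R →+* A) :
    map f (hyperbolic R) = hyperbolic A := by
  simp only [hyperbolic, map_add, map_ofForm_rankOne, map_one, map_neg]

/-- The product is ⟨a⟩ + ⟨-a⟩, the class of a plane. -/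
theorem ofForm_rankOne_mul_hyperbolic [IsLocalRing R] {a : R} (ha : IsUnit a) :
    ofForm (rankOne a ha) * hyperbolic R = hyperbolic R := by
  conv_rhs => rw [← ofForm_rankOne_add_neg ha]
  rw [hyperbolic, mul_add, ofForm_mul_ofForm, ofForm_mul_ofForm,
    ofForm_eq (rankOne_tensor_isometric ha isUnit_one),
    ofForm_eq (rankOne_tensor_isometric ha isUnit_one.neg)]
  simp only [mul_one, mul_neg]

end GWSym

/-! ### Gauss sums -/

namespace UnimodularForm

variable {R : Type u} [CommRing R] {K : Type*}

instance finite_carrier [Finite R] (M : UnimodularForm R) : Finite M.carrier :=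
  Module.finite_of_finite R

/-- The sum of the values of an additive character on the norms of a form. -/
noncomputable def charSum [CommRing K] (ψ : AddChar R K) (M : UnimodularForm R) : K :=
  ∑ᶠ x : M.carrier, ψ (M.form x x)

theorem Isometric.charSum_eq [CommRing K] (ψ : AddChar R K) {M N : UnimodularForm R}
    (h : M.Isometric N) : M.charSum ψ = N.charSum ψ := by
  obtain ⟨e, he⟩ := h
  simp only [charSum, ← he]
  exact finsum_comp_equiv (f := fun y => ψ (N.form y y)) e.toEquiv

theorem charSum_orthSum [Finite R] [CommRing K] (ψ : AddChar R K) (M N : UnimodularForm R) :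
    (M.orthSum N).charSum ψ = M.charSum ψ * N.charSum ψ := by
  let _ := Fintype.ofFinite M.carrier
  let _ := Fintype.ofFinite N.carrier
  have h : (M.orthSum N).charSum ψ
      = ∑ᶠ x : M.carrier × N.carrier, ψ (M.form x.1 x.1 + N.form x.2 x.2) := rfl
  rw [h, charSum, charSum, finsum_eq_sum_of_fintype, finsum_eq_sum_of_fintype,
    finsum_eq_sum_of_fintype, Fintype.sum_mul_sum, Fintype.sum_prod_type]
  simp only [AddChar.map_add_eq_mul]

theorem charSum_zero [CommRing K] (ψ : AddChar R K) : (zero R).charSum ψ = 1 := by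
  have h : (zero R).charSum ψ = ∑ᶠ _ : PUnit.{u + 1}, ψ 0 := rfl
  rw [h, finsum_eq_sum_of_fintype]
  simp

theorem charSum_rankOne [CommRing K] [Fintype R] (ψ : AddChar R K) {a : R} (ha : IsUnit a) :
    (rankOne a ha).charSum ψ = ∑ x : R, ψ (a * (x * x)) :=
  finsum_eq_sum_of_fintype fun x : R => ψ (a * (x * x))

/-- The Gauss sum as a homomorphism on isometry classes. -/
noncomputable def charSumHom [Finite R] [CommRing K] (ψ : AddChar R K) :
    Multiplicative (SymClass R) →* K where
  toFun c := Quotient.lift (charSum ψ) (fun _ _ h => Isometric.charSum_eq ψ h) c.toAdd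
  map_one' := charSum_zero ψ
  map_mul' := by
    intro x y
    induction x with | ofAdd x
    induction y with | ofAdd y
    induction x using SymClass.ind with | h M
    induction y using SymClass.ind with | h N
    exact charSum_orthSum ψ M N

/-- Adding ⟨1⟩ makes the class diagonal, so its Gauss sum divides a product of rank-one Gauss sums,
and divisors of units are units. -/
theorem isUnit_charSumHom [Finite R] [IsLocalRing R] [CommRing K] {ψ : AddChar R K}
    (h : ∀ (a : R) (ha : IsUnit a), IsUnit ((rankOne a ha).charSum ψ)) (c : SymClass R) :
    IsUnit (charSumHom ψ (Multiplicative.ofAdd c)) := by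
  have h1 : ∀ c ∈ diagonalClasses R, IsUnit (charSumHom ψ (Multiplicative.ofAdd c)) := by
    intro c hc
    induction hc using AddSubmonoid.closure_induction with
    | mem c hc =>
      obtain ⟨a, ha, rfl⟩ := hc
      exact h a ha
    | zero => rw [ofAdd_zero, map_one]; exact isUnit_one
    | add x y _ _ hx hy => rw [ofAdd_add, map_mul]; exact hx.mul hy
  have h2 := h1 _ (mk_add_one_mem_diagonalClasses c)
  rw [ofAdd_add, map_mul] at h2
  exact isUnit_of_mul_isUnit_left h2

end UnimodularForm

namespace GWSym

open UnimodularForm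

variable {R : Type u} [CommRing R] [Finite R] [IsLocalRing R] {K : Type*} [CommRing K]

/-- The Gauss sum as a homomorphism on the Grothendieck-Witt group. -/
theorem exists_charSum {ψ : AddChar R K}
    (h : ∀ (a : R) (ha : IsUnit a), IsUnit ((rankOne a ha).charSum ψ)) :
    ∃ χ : GWSym R →+ Additive Kˣ, ∀ M, ((χ (ofForm M)).toMul : K) = M.charSum ψ := by
  refine ⟨Algebra.GrothendieckAddGroup.lift (MonoidHom.toAdditiveRight (Units.liftRight
    (charSumHom ψ) (fun c => (isUnit_charSumHom h c.toAdd).unit) fun _ => rfl)), fun M => ?_⟩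
  rw [ofForm, GroupCompletion.lift_incl]
  rfl

end GWSym

instance isLocalRing_zmod_two_pow (n : ℕ) [NeZero n] : IsLocalRing (ZMod (2 ^ n)) :=
  have : Nontrivial (ZMod (2 ^ n)) :=
    ZMod.nontrivial_iff.2 (Nat.one_lt_two_pow (NeZero.ne n)).ne'
  .of_surjective' (PadicInt.toZModPow (p := 2) n) (ZMod.ringHom_surjective _)

/-! ### Independence of the generators over `ℤ/8`. -/

namespace GWSym

open UnimodularForm

/-- The character of `ℤ/8` defined by an eighth root of unity. -/
noncomputable abbrev rootChar {K : Type*} [CommRing K] (ζ : K) (h : ζ ^ 2 ^ 3 = 1) :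
    AddChar (ZMod (2 ^ 3)) K :=
  AddChar.zmodChar (2 ^ 3) h

theorem charSum_rankOne_rootChar {K : Type*} [CommRing K] (ζ : K) (h : ζ ^ 2 ^ 3 = 1)
    {a : ZMod (2 ^ 3)} (ha : IsUnit a) :
    (rankOne a ha).charSum (rootChar ζ h) = ∑ x : ZMod (2 ^ 3), ζ ^ (a * (x * x)).val := by
  rw [charSum_rankOne]
  simp only [AddChar.zmodChar_apply]

theorem exists_charSum_rootChar {K : Type*} [CommRing K] (ζ : K) (h : ζ ^ 2 ^ 3 = 1)
    (hu : ∀ a : ZMod (2 ^ 3), IsUnit a → IsUnit (∑ x : ZMod (2 ^ 3), ζ ^ (a * (x * x)).val)) :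
    ∃ χ : GWSym (ZMod (2 ^ 3)) →+ Additive Kˣ, ∀ (a : ZMod (2 ^ 3)) (ha : IsUnit a),
      ((χ (ofForm (rankOne a ha))).toMul : K) = ∑ x : ZMod (2 ^ 3), ζ ^ (a * (x * x)).val := by
  obtain ⟨χ, hχ⟩ := exists_charSum (ψ := rootChar ζ h) fun a ha => by
    rw [charSum_rankOne_rootChar]
    exact hu a ha
  exact ⟨χ, fun a ha => by rw [hχ, charSum_rankOne_rootChar]⟩

theorem isUnit_three_zmod_eight : IsUnit (3 : ZMod (2 ^ 3)) := by decide

theorem isUnit_five_zmod_eight : IsUnit (5 : ZMod (2 ^ 3)) := by decide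

/-- For the root of unity 1 the Gauss sum counts elements: every rank-one form gives 8, and the
relation becomes `8 ^ a = 1` in ℚ. -/
theorem rank_eq_zero_of_combination_eq_zero {a b c : ℤ}
    (h : a • ofForm (rankOne (1 : ZMod (2 ^ 3)) isUnit_one)
      + b • (ofForm (rankOne (3 : ZMod (2 ^ 3)) isUnit_three_zmod_eight)
        - ofForm (rankOne (1 : ZMod (2 ^ 3)) isUnit_one))
      + c • (ofForm (rankOne (5 : ZMod (2 ^ 3)) isUnit_five_zmod_eight)
        - ofForm (rankOne (1 : ZMod (2 ^ 3)) isUnit_one)) = 0) : a = 0 := by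
  obtain ⟨χ, hχ⟩ := exists_charSum_rootChar (1 : ℚ) (one_pow _) (fun a _ => by simp)
  have h1 : ∀ (u : ZMod (2 ^ 3)) (hu : IsUnit u),
      χ (ofForm (rankOne u hu)) = Additive.ofMul (Units.mk0 (8 : ℚ) (by norm_num)) := fun u hu => by
    refine Additive.toMul.injective (Units.ext ?_)
    rw [hχ]
    simp
  have h2 := congrArg χ h
  simp only [map_add, map_sub, map_zsmul, map_zero, h1, sub_self, smul_zero, add_zero] at h2
  have h3 := congrArg (fun t : Additive ℚˣ => (t.toMul : ℚ)) h2
  simp only [toMul_zsmul, toMul_ofMul, Units.val_zpow_eq_zpow_val, Units.val_mk0, toMul_zero,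
    Units.val_one] at h3
  exact (zpow_eq_one_iff_right₀ (by norm_num) (by norm_num)).1 h3

/-- Modulo 17, the root ζ = 2 has ζ⁴ = -1 and the Gauss sum of ⟨a⟩ is 2 + 4ζᵃ + 2ζ⁴ = 4ζᵃ; the
relation gives 2b + 4c ≡ 0 modulo 8, which still allows b = 2, c = 1. The root 4, of order 4, gives
4 + 4·4ᵃ: equal values for ⟨1⟩ and ⟨5⟩, and a ratio of order 4 between ⟨3⟩ and ⟨1⟩, so b = 0. The
finite field makes all of this decidable. -/
theorem eq_zero_of_combination_eq {b c : ℕ} (hb : b < 4) (hc : c < 2)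
    (h : b • ofForm (rankOne (3 : ZMod (2 ^ 3)) isUnit_three_zmod_eight)
      + c • ofForm (rankOne (5 : ZMod (2 ^ 3)) isUnit_five_zmod_eight)
      = (b + c) • ofForm (rankOne (1 : ZMod (2 ^ 3)) isUnit_one)) : b = 0 ∧ c = 0 := by
  obtain ⟨χ, hχ⟩ := exists_charSum_rootChar (2 : ZMod 17) (by decide) (by decide)
  obtain ⟨χ', hχ'⟩ := exists_charSum_rootChar (4 : ZMod 17) (by decide) (by decide)
  have h2 := congrArg (fun t : Additive (ZMod 17)ˣ => (t.toMul : ZMod 17)) (congrArg χ h)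
  have h3 := congrArg (fun t : Additive (ZMod 17)ˣ => (t.toMul : ZMod 17)) (congrArg χ' h)
  simp only [map_add, map_nsmul, toMul_add, toMul_nsmul, Units.val_mul, Units.val_pow_eq_pow_val,
    hχ, hχ'] at h2 h3
  interval_cases b <;> interval_cases c <;> revert h2 h3 <;> decide

end GWSym

/-! ### Rings with the square classes of the dyadic integers -/

/-- Every element congruent to `1` modulo `8` is the square of a unit, and every unit is congruent
to an odd integer modulo `8`. -/
structure HasDyadicSquareClasses (R : Type*) [CommRing R] : Prop where
  exists_sq : ∀ t : R, ∃ s, IsUnit s ∧ 1 + 8 * t = s ^ 2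
  exists_odd : ∀ u : R, IsUnit u → ∃ t,
    u = 1 + 8 * t ∨ u = 3 + 8 * t ∨ u = 5 + 8 * t ∨ u = 7 + 8 * t

theorem HasDyadicSquareClasses.of_surjective {R A : Type*} [CommRing R] [CommRing A]
    (h : HasDyadicSquareClasses R) (f : R →+* A) [IsLocalHom f] (hf : Function.Surjective f) :
    HasDyadicSquareClasses A where
  exists_sq t := by
    obtain ⟨t, rfl⟩ := hf t
    obtain ⟨s, hs, e⟩ := h.exists_sq t
    exact ⟨f s, hs.map f, by simpa [map_ofNat f] using congrArg f e⟩
  exists_odd u hu := by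
    obtain ⟨u, rfl⟩ := hf u
    obtain ⟨t, ht⟩ := h.exists_odd u (isUnit_of_map_unit f u hu)
    refine ⟨f t, ?_⟩
    rcases ht with rfl | rfl | rfl | rfl <;> simp [map_ofNat f]

theorem hasDyadicSquareClasses_padicInt : HasDyadicSquareClasses ℤ_[2] where
  exists_sq t := by
    have h8 : ‖(8 * t : ℤ_[2])‖ ≤ 1 / 8 := by
      have h : ‖(2 ^ 3 : ℤ_[2])‖ = 1 / 8 := by
        have := PadicInt.norm_p_pow (p := 2) 3
        push_cast at this
        rw [this]
        norm_num
      rw [show (8 : ℤ_[2]) = 2 ^ 3 by norm_num, norm_mul, h]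
      exact mul_le_of_le_one_right (by norm_num) (PadicInt.norm_le_one t)
    have h2 : ‖(2 : ℤ_[2])‖ = 1 / 2 := by
      have := PadicInt.norm_p (p := 2)
      push_cast at this
      rw [this]
      norm_num
    -- Hensel's condition at 1 holds since |F(1)| = |8t| ≤ 1/8 < 1/4 = |F'(1)|².
    obtain ⟨s, hs, -⟩ := hensels_lemma (p := 2) (R := ℤ_[2])
      (F := Polynomial.X ^ 2 - Polynomial.C (1 + 8 * t)) (a := 1) (by
        simp only [map_sub, map_pow, Polynomial.aeval_X, Polynomial.aeval_C,
          Polynomial.derivative_X_pow, Polynomial.derivative_C]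
        simp only [one_pow, Algebra.algebraMap_self, RingHom.id_apply, map_mul, map_pow,
          Polynomial.aeval_X, mul_one, Polynomial.aeval_C]
        rw [show (1 : ℤ_[2]) - (1 + 8 * t) = -(8 * t) by ring, norm_neg]
        norm_num
        rw [← norm_mul, h2]
        exact h8.trans_lt (by norm_num))
    have hs' : 1 + 8 * t = s ^ 2 := by
      simp only [map_sub, map_pow, Polynomial.aeval_X, Polynomial.aeval_C,
        Algebra.algebraMap_self, RingHom.id_apply] at hs
      exact (sub_eq_zero.1 hs).symm
    refine ⟨s, ?_, hs'⟩
    have h1 : IsUnit (1 + 8 * t) := by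
      rw [PadicInt.isUnit_iff, PadicInt.norm_add_eq_max_of_ne, norm_one, max_eq_left]
      · exact h8.trans (by norm_num)
      · rw [norm_one]
        exact (h8.trans_lt (by norm_num)).ne'
    rw [hs'] at h1
    exact (isUnit_pow_iff two_ne_zero).1 h1
  exists_odd u hu := by
    have key : ∀ k : ℕ, PadicInt.toZModPow 3 u = (k : ZMod (2 ^ 3)) → ∃ t, u = k + 8 * t := by
      intro k hk
      have h : u - k ∈ RingHom.ker (PadicInt.toZModPow (p := 2) 3) := by
        rw [RingHom.mem_ker, map_sub, hk, map_natCast, sub_self]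
      rw [PadicInt.ker_toZModPow, Ideal.mem_span_singleton] at h
      obtain ⟨t, ht⟩ := h
      refine ⟨t, ?_⟩
      push_cast at ht
      linear_combination ht
    have h1 : ∀ v : ZMod (2 ^ 3), IsUnit v → v = (1 : ℕ) ∨ v = (3 : ℕ) ∨ v = (5 : ℕ) ∨
        v = (7 : ℕ) := by decide
    rcases h1 _ (hu.map (PadicInt.toZModPow (p := 2) 3)) with h | h | h | h <;>
      obtain ⟨t, ht⟩ := key _ h <;> refine ⟨t, ?_⟩ <;> simp [ht]

instance isLocalHom_toZModPow (n : ℕ) [NeZero n] :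
    IsLocalHom (PadicInt.toZModPow n : ℤ_[2] →+* ZMod (2 ^ n)) :=
  have : Nontrivial (ZMod (2 ^ n)) :=
    ZMod.nontrivial_iff.2 (Nat.one_lt_two_pow (NeZero.ne n)).ne'
  .of_surjective _ (ZMod.ringHom_surjective _)

theorem hasDyadicSquareClasses_zmod (n : ℕ) [NeZero n] :
    HasDyadicSquareClasses (ZMod (2 ^ n)) :=
  hasDyadicSquareClasses_padicInt.of_surjective (PadicInt.toZModPow n)
    (ZMod.ringHom_surjective _)

/-! ### Generators and relations for the Grothendieck-Witt group. -/

namespace HasDyadicSquareClasses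

section Units

variable {R : Type*} [CommRing R] (h : HasDyadicSquareClasses R)
include h

theorem isUnit_one_add (t : R) : IsUnit (1 + 8 * t) := by
  obtain ⟨s, hs, e⟩ := h.exists_sq t
  rw [e]
  exact hs.pow 2

theorem isUnit_three : IsUnit (3 : R) :=
  isUnit_of_dvd_unit ⟨3, by ring⟩ (h.isUnit_one_add 1)

theorem isUnit_five : IsUnit (5 : R) :=
  isUnit_of_dvd_unit ⟨5, by ring⟩ (h.isUnit_one_add 3)

theorem isUnit_seven : IsUnit (7 : R) :=
  isUnit_of_dvd_unit ⟨7, by ring⟩ (h.isUnit_one_add 6)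

end Units

open UnimodularForm GWSym

variable {R : Type u} [CommRing R] (h : HasDyadicSquareClasses R)

include h in
-- The quotient b/a = 1 + 8t/a is the square of a unit.
theorem ofForm_rankOne_eq {a b t : R} (ha : IsUnit a) (hb : IsUnit b) (e : b = a + 8 * t) :
    ofForm (rankOne b hb) = ofForm (rankOne a ha) := by
  obtain ⟨r, hr⟩ := ha.exists_right_inv
  obtain ⟨s, hs, hst⟩ := h.exists_sq (r * t)
  refine ofForm_eq (rankOne_isometric ha hb hs ?_)
  rw [← hst, e]
  linear_combination -8 * t * hr

include h in
theorem two_smul_ofForm_five :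
    (2 : ℤ) • (ofForm (rankOne (5 : R) h.isUnit_five) - ofForm (rankOne (1 : R) isUnit_one))
      = 0 := by
  have h5 : IsUnit (1 + 4 * 1 : R) := by convert h.isUnit_five using 1; norm_num
  have e := ofForm_eq (rankOne_orthSum_isometric isUnit_one isUnit_one h5)
  rw [ofForm_orthSum, ofForm_orthSum,
    h.ofForm_rankOne_eq h.isUnit_five h5 (t := 0) (by norm_num),
    h.ofForm_rankOne_eq h.isUnit_five (t := 0)
      ((isUnit_one.mul isUnit_one).mul h5) (by norm_num)] at e
  rw [smul_sub, two_smul, two_smul, e, sub_self]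

include h in
-- The relation ⟨a⟩ + ⟨b⟩ = ⟨a + 4b⟩ + ⟨ab(a + 4b)⟩ with a = 1, b = 3 has right side ⟨13⟩ + ⟨39⟩ =
-- ⟨5⟩ + ⟨7⟩.
theorem ofForm_seven : ofForm (rankOne (7 : R) h.isUnit_seven)
    = ofForm (rankOne (1 : R) isUnit_one) + ofForm (rankOne (3 : R) h.isUnit_three)
      - ofForm (rankOne (5 : R) h.isUnit_five) := by
  have h13 : IsUnit (1 + 4 * 3 : R) := isUnit_of_dvd_unit ⟨5, by ring⟩ (h.isUnit_one_add 8)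
  have e := ofForm_eq (rankOne_orthSum_isometric isUnit_one h.isUnit_three h13)
  rw [ofForm_orthSum, ofForm_orthSum,
    h.ofForm_rankOne_eq h.isUnit_five h13 (t := 1) (by norm_num),
    h.ofForm_rankOne_eq h.isUnit_seven (t := 4)
      ((isUnit_one.mul h.isUnit_three).mul h13) (by norm_num)] at e
  rw [← e]
  abel

include h in
theorem four_smul_ofForm_three :
    (4 : ℤ) • (ofForm (rankOne (3 : R) h.isUnit_three) - ofForm (rankOne (1 : R) isUnit_one))
      = 0 := by
  have e := ofForm_eq (rankOne_four_isometric isUnit_one h.isUnit_three h.isUnit_three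
    (mul_one 3).symm)
  simp only [ofForm_orthSum] at e
  rw [smul_sub, sub_eq_zero]
  calc _ = _ := by abel
    _ = _ := e
    _ = _ := by abel

/-- The homomorphism `(a, b, c) ↦ a⟨1⟩ + b(⟨3⟩ - ⟨1⟩) + c(⟨5⟩ - ⟨1⟩)`. -/
noncomputable def comparison : ℤ × ZMod 4 × ZMod 2 →+ GWSym R :=
  (zmultiplesHom _ (ofForm (rankOne (1 : R) isUnit_one))).coprod
    ((ZMod.lift 4 ⟨zmultiplesHom _ (ofForm (rankOne (3 : R) h.isUnit_three)
        - ofForm (rankOne (1 : R) isUnit_one)), h.four_smul_ofForm_three⟩).coprod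
      (ZMod.lift 2 ⟨zmultiplesHom _ (ofForm (rankOne (5 : R) h.isUnit_five)
        - ofForm (rankOne (1 : R) isUnit_one)), h.two_smul_ofForm_five⟩))

theorem comparison_apply (a b c : ℤ) : h.comparison (a, (b : ZMod 4), (c : ZMod 2))
    = a • ofForm (rankOne (1 : R) isUnit_one)
      + b • (ofForm (rankOne (3 : R) h.isUnit_three) - ofForm (rankOne (1 : R) isUnit_one))
      + c • (ofForm (rankOne (5 : R) h.isUnit_five) - ofForm (rankOne (1 : R) isUnit_one)) := by
  simp only [comparison, AddMonoidHom.coprod_apply, ZMod.lift_coe, zmultiplesHom_apply, add_assoc]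

theorem comparison_ind {p : ℤ × ZMod 4 × ZMod 2 → Prop}
    (hp : ∀ a b c : ℤ, p (a, (b : ZMod 4), (c : ZMod 2))) (x : ℤ × ZMod 4 × ZMod 2) : p x := by
  obtain ⟨a, b, c⟩ := x
  obtain ⟨b, rfl⟩ := ZMod.intCast_surjective b
  obtain ⟨c, rfl⟩ := ZMod.intCast_surjective c
  exact hp a b c

theorem map_comparison {A : Type u} [CommRing A] (hA : HasDyadicSquareClasses A) (f : R →+* A)
    (x : ℤ × ZMod 4 × ZMod 2) : GWSym.map f (h.comparison x) = hA.comparison x := by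
  induction x using comparison_ind with
  | hp a b c =>
    simp only [comparison_apply, map_add, map_sub, map_zsmul, map_ofForm_rankOne, map_one,
      map_ofNat]

theorem ofForm_rankOne_mem_range {a : R} (ha : IsUnit a) :
    ofForm (rankOne a ha) ∈ h.comparison.range := by
  obtain ⟨t, rfl | rfl | rfl | rfl⟩ := h.exists_odd a ha
  · refine ⟨(1, (0 : ℤ), (0 : ℤ)), ?_⟩
    rw [comparison_apply, h.ofForm_rankOne_eq isUnit_one ha rfl]
    simp only [zero_smul, one_smul]
    abel
  · refine ⟨(1, (1 : ℤ), (0 : ℤ)), ?_⟩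
    rw [comparison_apply, h.ofForm_rankOne_eq h.isUnit_three ha rfl]
    simp only [zero_smul, one_smul]
    abel
  · refine ⟨(1, (0 : ℤ), (1 : ℤ)), ?_⟩
    rw [comparison_apply, h.ofForm_rankOne_eq h.isUnit_five ha rfl]
    simp only [zero_smul, one_smul]
    abel
  · refine ⟨(1, (1 : ℤ), (-1 : ℤ)), ?_⟩
    rw [comparison_apply, h.ofForm_rankOne_eq h.isUnit_seven ha rfl, h.ofForm_seven]
    simp only [one_smul, neg_smul]
    abel

theorem comparison_surjective [IsLocalRing R] : Function.Surjective h.comparison := by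
  have h1 : ∀ c ∈ diagonalClasses R, GroupCompletion.incl c ∈ h.comparison.range := by
    intro c hc
    induction hc using AddSubmonoid.closure_induction with
    | mem c hc =>
      obtain ⟨a, ha, rfl⟩ := hc
      exact h.ofForm_rankOne_mem_range ha
    | zero => rw [map_zero]; exact zero_mem _
    | add x y _ _ hx hy => rw [map_add]; exact add_mem hx hy
  intro x
  change x ∈ h.comparison.range
  induction x using GroupCompletion.induction with
  | of c =>
    have h2 := h1 _ (mk_add_one_mem_diagonalClasses c)
    rw [map_add] at h2
    exact (add_mem_cancel_right (h1 _ (rankOne_mem_diagonalClasses isUnit_one))).1 h2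
  | sub x y hx hy => exact sub_mem hx hy

theorem comparison_injective {R : Type} [CommRing R] (h : HasDyadicSquareClasses R)
    (f : R →+* ZMod (2 ^ 3)) : Function.Injective h.comparison := by
  have hA := hasDyadicSquareClasses_zmod 3
  refine (injective_iff_map_eq_zero _).2 fun x hx => ?_
  have h1 := h.map_comparison hA f x
  rw [hx, map_zero] at h1
  obtain ⟨a, b, c⟩ := x
  -- Lifts in the ranges [0, 4) and [0, 2) leave finitely many cases for the Gauss sums.
  have hb : b = ((b.val : ℤ) : ZMod 4) := by simp
  have hc : c = ((c.val : ℤ) : ZMod 2) := by simp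
  rw [hb, hc, comparison_apply] at h1
  have ha := rank_eq_zero_of_combination_eq_zero h1.symm
  rw [ha, zero_smul, zero_add, natCast_zsmul, natCast_zsmul, smul_sub, smul_sub] at h1
  obtain ⟨hb0, hc0⟩ := eq_zero_of_combination_eq (ZMod.val_lt b) (ZMod.val_lt c) (by
    rw [add_smul, ← sub_eq_zero, h1]
    abel)
  rw [ha, (ZMod.val_eq_zero b).1 hb0, (ZMod.val_eq_zero c).1 hc0]
  rfl

/-- The comparison maps of `R` and `A` are bijective and commute with `GWSym.map f`. The map `g`
provides the reduction to `ℤ/8` on which their injectivity rests. -/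
theorem bijective_map {R A : Type} [CommRing R] [IsLocalRing R] [CommRing A] [IsLocalRing A]
    (h : HasDyadicSquareClasses R) (hA : HasDyadicSquareClasses A) (f : R →+* A) (g : A →+* ZMod (2 ^ 3)) :
    Function.Bijective (GWSym.map f) := by
  have e : GWSym.map f ∘ h.comparison = hA.comparison := funext (h.map_comparison hA f)
  have hb : Function.Bijective (GWSym.map f ∘ h.comparison) := by
    rw [e]
    exact ⟨hA.comparison_injective g, hA.comparison_surjective⟩
  exact (Function.Bijective.of_comp_iff _
    ⟨h.comparison_injective (g.comp f), h.comparison_surjective⟩).1 hb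

/-! ### The Witt group -/

/-- As -1 ≡ 7 modulo 8, the hyperbolic class is ⟨1⟩ + ⟨7⟩ = 2⟨1⟩ + (⟨3⟩ - ⟨1⟩) - (⟨5⟩ - ⟨1⟩), and
the last term is 2-torsion. -/
theorem comparison_hyperbolic : h.comparison (2, (1 : ℤ), (1 : ℤ)) = hyperbolic R := by
  have e := h.two_smul_ofForm_five
  rw [comparison_apply, hyperbolic,
    h.ofForm_rankOne_eq h.isUnit_seven (t := -1) isUnit_one.neg (by ring), h.ofForm_seven,
    ← sub_eq_zero, ← e]
  abel

theorem comparison_mul_hyperbolic [IsLocalRing R] (a b c : ℤ) :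
    h.comparison (a, (b : ZMod 4), (c : ZMod 2)) * hyperbolic R = a • hyperbolic R := by
  rw [comparison_apply]
  simp only [add_mul, sub_mul, smul_mul_assoc, ofForm_rankOne_mul_hyperbolic, sub_self, smul_zero,
    add_zero]

include h in
theorem mem_metabolicIdeal [IsLocalRing R] {x : GWSym R} :
    x ∈ metabolicIdeal R ↔ ∃ k : ℤ, k • hyperbolic R = x := by
  rw [metabolicIdeal_eq_span, Ideal.mem_span_singleton']
  constructor
  · rintro ⟨y, rfl⟩
    obtain ⟨y, rfl⟩ := h.comparison_surjective y
    induction y using comparison_ind with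
    | hp a b c => exact ⟨a, (h.comparison_mul_hyperbolic a b c).symm⟩
  · rintro ⟨k, rfl⟩
    exact ⟨_, h.comparison_mul_hyperbolic k 0 0⟩

/-- The homomorphism `(a, b, c) ↦ (a - 2 b, b + c)`. -/
def wittHom : ℤ × ZMod 4 × ZMod 2 →+ ZMod 8 × ZMod 2 :=
  (zmultiplesHom _ (1, 0)).coprod
    ((ZMod.lift 4 ⟨zmultiplesHom _ (-2, 1), by decide⟩).coprod
      (ZMod.lift 2 ⟨zmultiplesHom _ (0, 1), by decide⟩))

theorem wittHom_apply (a b c : ℤ) : wittHom (a, (b : ZMod 4), (c : ZMod 2))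
    = (((a - 2 * b : ℤ) : ZMod 8), ((b + c : ℤ) : ZMod 2)) := by
  simp only [wittHom, AddMonoidHom.coprod_apply, ZMod.lift_coe, zmultiplesHom_apply]
  ext
  · simp
    ring
  · simp

theorem wittHom_surjective : Function.Surjective wittHom := by
  rintro ⟨x, y⟩
  obtain ⟨x, rfl⟩ := ZMod.intCast_surjective x
  obtain ⟨y, rfl⟩ := ZMod.intCast_surjective y
  exact ⟨(x, (0 : ℤ), (y : ℤ)), by rw [wittHom_apply]; simp⟩

theorem wittHom_eq_zero_iff {x : ℤ × ZMod 4 × ZMod 2} :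
    wittHom x = 0 ↔ ∃ k : ℤ, k • ((2, (1 : ℤ), (1 : ℤ)) : ℤ × ZMod 4 × ZMod 2) = x := by
  constructor
  · induction x using comparison_ind with
    | hp a b c =>
      intro hx
      rw [wittHom_apply, Prod.mk_eq_zero, ZMod.intCast_zmod_eq_zero_iff_dvd,
        ZMod.intCast_zmod_eq_zero_iff_dvd] at hx
      obtain ⟨⟨i, hi⟩, ⟨j, hj⟩⟩ := hx
      push_cast at hi hj
      -- The first coordinate forces 2k = a = 2b + 8i; this k agrees with b modulo 4, and with c
      -- modulo 2 since b + c is even.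
      refine ⟨b + 4 * i, Prod.ext ?_ (Prod.ext ?_ ?_)⟩
      · simp
        linarith
      · have h4 : (4 : ZMod 4) = 0 := rfl
        simp [h4]
      · have h4 : (4 : ZMod 2) = 0 := rfl
        have hc : (c : ZMod 2) = b := by
          rw [ZMod.intCast_eq_intCast_iff_dvd_sub]
          exact ⟨b - j, by push_cast; linarith⟩
        simp [h4, hc]
  · rintro ⟨k, rfl⟩
    rw [map_zsmul, show wittHom (2, (1 : ℤ), (1 : ℤ)) = 0 by rw [wittHom_apply]; rfl, smul_zero]

theorem nonempty_wSym_addEquiv {R : Type} [CommRing R] [IsLocalRing R]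
    (h : HasDyadicSquareClasses R) (f : R →+* ZMod (2 ^ 3)) :
    Nonempty (WSym R ≃+ ZMod 8 × ZMod 2) := by
  let E := AddEquiv.ofBijective h.comparison
    ⟨h.comparison_injective f, h.comparison_surjective⟩
  let q : ℤ × ZMod 4 × ZMod 2 →+ WSym R :=
    (Ideal.Quotient.mk (metabolicIdeal R)).toAddMonoidHom.comp h.comparison
  have hq : Function.Surjective q :=
    Ideal.Quotient.mk_surjective.comp h.comparison_surjective
  have hk : q.ker = wittHom.ker := by
    ext x
    rw [AddMonoidHom.mem_ker, AddMonoidHom.mem_ker, wittHom_eq_zero_iff]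
    refine Ideal.Quotient.eq_zero_iff_mem.trans (h.mem_metabolicIdeal.trans ?_)
    refine exists_congr fun k => ?_
    rw [← h.comparison_hyperbolic, ← map_zsmul]
    exact (h.comparison_injective f).eq_iff
  exact ⟨(QuotientAddGroup.quotientKerEquivOfSurjective q hq).symm.trans
    ((QuotientAddGroup.quotientAddEquivOfEq hk).trans
      (QuotientAddGroup.quotientKerEquivOfSurjective wittHom wittHom_surjective))⟩

/-- Both metabolic ideals are generated by the hyperbolic class, which extension of scalars
preserves. -/
theorem exists_wSym_ringEquiv [IsLocalRing R] {A : Type u} [CommRing A] [IsLocalRing A]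
    {f : R →+* A} (hf : Function.Bijective (GWSym.map f)) :
    ∃ e : WSym R ≃+* WSym A, ∀ x : GWSym R,
      e (Ideal.Quotient.mk (metabolicIdeal R) x)
        = Ideal.Quotient.mk (metabolicIdeal A) (GWSym.map f x) := by
  refine ⟨Ideal.quotientEquiv _ _ (RingEquiv.ofBijective (GWSym.map f) hf) ?_, fun x => rfl⟩
  rw [metabolicIdeal_eq_span, metabolicIdeal_eq_span, Ideal.map_span, Set.image_singleton]
  congr 2
  exact (map_hyperbolic f).symm

end HasDyadicSquareClasses

/-! ### Assembly for the 2-adic integers and their quotients. -/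

open HasDyadicSquareClasses in
theorem mainTheorem5 :
    -- all projections between `ℤ/2^m` and `ℤ/2^n`, for `m ≥ n ≥ 3`, induce isomorphisms
    (∀ (m n : ℕ) (_ : 3 ≤ n) (hnm : n ≤ m),
      Function.Bijective
        (GWSym.map (ZMod.castHom (pow_dvd_pow 2 hnm) (ZMod (2 ^ n)) :
          ZMod (2 ^ m) →+* ZMod (2 ^ n)))) ∧
    -- so do the projections from the `2`-adic integers
    (∀ n : ℕ, 3 ≤ n →
      Function.Bijective (GWSym.map (PadicInt.toZModPow n : ℤ_[2] →+* ZMod (2 ^ n)))) ∧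
    -- the Grothendieck-Witt groups
    (∀ n : ℕ, 3 ≤ n → Nonempty (GWSym (ZMod (2 ^ n)) ≃+ ℤ × ZMod 4 × ZMod 2)) ∧
    Nonempty (GWSym ℤ_[2] ≃+ ℤ × ZMod 4 × ZMod 2) ∧
    -- the Witt groups; the isomorphism between them is induced by the projection
    (∀ n : ℕ, 3 ≤ n →
      ∃ e : WSym ℤ_[2] ≃+* WSym (ZMod (2 ^ n)), ∀ x : GWSym ℤ_[2],
        e (Ideal.Quotient.mk (GWSym.metabolicIdeal ℤ_[2]) x)
          = Ideal.Quotient.mk (GWSym.metabolicIdeal (ZMod (2 ^ n)))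
              (GWSym.map (PadicInt.toZModPow n : ℤ_[2] →+* ZMod (2 ^ n)) x)) ∧
    (∀ n : ℕ, 3 ≤ n → Nonempty (WSym (ZMod (2 ^ n)) ≃+ ZMod 8 × ZMod 2)) ∧
    Nonempty (WSym ℤ_[2] ≃+ ZMod 8 × ZMod 2) := by
  have hne : ∀ {n : ℕ}, 3 ≤ n → NeZero n := fun hn => ⟨by omega⟩
  have g : ∀ {n : ℕ}, 3 ≤ n → (ZMod (2 ^ n) →+* ZMod (2 ^ 3)) := fun hn =>
    ZMod.castHom (pow_dvd_pow 2 hn) _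
  have hZ := hasDyadicSquareClasses_padicInt
  have hGW : ∀ n : ℕ, 3 ≤ n →
      Function.Bijective (GWSym.map (PadicInt.toZModPow n : ℤ_[2] →+* ZMod (2 ^ n))) :=
    fun n hn => have := hne hn; hZ.bijective_map (hasDyadicSquareClasses_zmod n) _ (g hn)
  refine ⟨fun m n hn hnm => ?_, hGW, fun n hn => ?_, ?_, fun n hn => ?_, fun n hn => ?_, ?_⟩
  · have := hne hn
    have := hne (hn.trans hnm)
    exact (hasDyadicSquareClasses_zmod m).bijective_map (hasDyadicSquareClasses_zmod n) _ (g hn)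
  · have := hne hn
    exact ⟨(AddEquiv.ofBijective _ ⟨(hasDyadicSquareClasses_zmod n).comparison_injective (g hn),
      (hasDyadicSquareClasses_zmod n).comparison_surjective⟩).symm⟩
  · exact ⟨(AddEquiv.ofBijective _ ⟨hZ.comparison_injective (PadicInt.toZModPow 3),
      hZ.comparison_surjective⟩).symm⟩
  · have := hne hn
    exact exists_wSym_ringEquiv (hGW n hn)
  · have := hne hn
    exact (hasDyadicSquareClasses_zmod n).nonempty_wSym_addEquiv (g hn)
  · exact hZ.nonempty_wSym_addEquiv (PadicInt.toZModPow 3)
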